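/- Let $\alpha\in(1/2,1]$ and $\varepsilon\in(0,1/16)$. Let $$\mathcal S_\alpha=\Big\{f:[0,1]\to\mathbb R\ :\ \sup_{0\le t\le 1}|f(t)|\le 1,\ |f(s)-f(t)|\le|s-t|^\alpha \text{ for all } s,t\in[0,1]\Big\},$$ and for an integer $N>0$ and integers $\ell,m$ with $0\le \ell\le N$ and $-N^\alpha-1\le m\le N^\alpha$ let $$R_{\ell m}=\Big[\frac{\ell}{N},\frac{\ell+1}{N}\Big]\times\Big[\frac{m}{N^\alpha},\frac{m+1}{N^\alpha}\Big].$$ There exist constants $c_1,c_2,c_3\in(0,\infty)$, depending only on $\alpha$ and $\varepsilon$, such that the following holds. Let $(W_t)_{t\ge0}$ be a one-dimensional standard Brownian motion, with $W_0=0$ a.s., on a probability space $(\Omega,\mathcal F,\mathbb P)$. For every integer $N>0$ there is an event $D_N\in\mathcal F$ such that (i) $\mathbb P(D_N)\le c_1\exp(-c_2N^{\varepsilon/2})$; (ii) if $\omega\notin D_N$ and $f\in\mathcal S_\alpha$, then at most $c_3N^{1/2+2\varepsilon}$ of the rectangles $R_{\ell m}$ that are contained in $[0,1]\times[-1,1]$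 contain both a point of the graph of $f$ and a point of the graph of $t\mapsto W_t(\omega)$. -/

import Mathlib

open MeasureTheory ProbabilityTheory
open scoped NNReal

/-- The class of all `f : [0,1] → ℝ` with `sup |f| ≤ 1` and
`|f s - f t| ≤ |s - t| ^ α` for all `s, t ∈ [0,1]`. -/
def holderClass (α : ℝ) : Set (unitInterval → ℝ) :=
  {f | (∀ t, |f t| ≤ 1) ∧ ∀ s t : unitInterval, |f s - f t| ≤ |(s : ℝ) - (t : ℝ)| ^ α}

/-- The closed grid rectangle
`[ℓ / N, (ℓ + 1) / N] × [m / N ^ α, (m + 1) / N ^ α]`. -/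
def gridRect (α : ℝ) (N ℓ : ℕ) (m : ℤ) : Set (ℝ × ℝ) :=
  Set.Icc ((ℓ : ℝ) / (N : ℝ)) (((ℓ : ℝ) + 1) / (N : ℝ)) ×ˢ
    Set.Icc ((m : ℝ) / (N : ℝ) ^ α) (((m : ℝ) + 1) / (N : ℝ) ^ α)

/-- The graph of a function on `[0,1]`, as a subset of the plane. -/
def curveGraph (f : unitInterval → ℝ) : Set (ℝ × ℝ) :=
  Set.range fun t : unitInterval => ((t : ℝ), f t)

/-- The graph of a path `w : [0,∞) → ℝ`, as a subset of the plane. -/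
def pathGraph (w : ℝ≥0 → ℝ) : Set (ℝ × ℝ) :=
  Set.range fun t : ℝ≥0 => ((t : ℝ), w t)

/-- The indices `(ℓ, m)`, with `0 ≤ ℓ ≤ N` and `-N ^ α - 1 ≤ m ≤ N ^ α`, of the grid rectangles
that lie in `[0,1] × [-1,1]` and contain both a point of the graph of `f` and a point of the graph
of the path `w`. For `N > 0` distinct indices give distinct rectangles. -/
def commonRects (α : ℝ) (N : ℕ) (f : unitInterval → ℝ) (w : ℝ≥0 → ℝ) : Set (ℕ × ℤ) :=
  {p | p.1 ≤ N ∧ -(N : ℝ) ^ α - 1 ≤ (p.2 : ℝ) ∧ (p.2 : ℝ) ≤ (N : ℝ) ^ α ∧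
    gridRect α N p.1 p.2 ⊆ Set.Icc (0 : ℝ) 1 ×ˢ Set.Icc (-1 : ℝ) 1 ∧
    (gridRect α N p.1 p.2 ∩ curveGraph f).Nonempty ∧
    (gridRect α N p.1 p.2 ∩ pathGraph w).Nonempty}

/-! Outside an event on which `W` oscillates unusually on some interval of length `1 / N`, a
rectangle met by both graphs forces `|W - f|` to be of order `N ^ (-1/2 + ε/2)` at its left grid
time `l / N`, and each such time accounts for at most five rectangles
(`exists_event_oscillation_le`, `commonRects_subset`). It remains to count these near times,
uniformly in `f`.

The count passes from coarse to fine time scales. Split a block of duration `N ^ (-a)` into `M ≈ N ^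
(a' - a)` blocks of duration `N ^ (-a')`, where `a' ≤ 2 * α * a`. On the coarse block `f` varies by
at most `N ^ (-α * a) ≤ N ^ (-a'/2)`, the Brownian scale of a fine block, so `f` may be replaced
there by a constant from a finite grid of levels. Given the past, Brownian motion is near a fixed
level in the `d`-th later fine block with probability of order `1 / √d`; hence about `√M ≈ N ^ ((a'
- a)/2)` fine blocks are hit per coarse block, and a count of order `N ^ (a/2)` becomes one of order
`N ^ (a'/2)`, up to small powers of `N`.

To make this hold at once for all `f`, exponential moments of the numbers of hits are multiplied
over the coarse blocks by the Markov property, and the sum over the levels is put inside the product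
(`blockGen`). Markov's inequality then treats every choice of coarse blocks and levels together, at
the price of one logarithm per coarse block actually met (`exists_event_total_hits_le`). Since `2 *
α > 1`, finitely many steps lead from the trivial scale `a = ε` to `a = 1 - ε` (`HitBound.base`,
`HitBound.step`, `HitBound.final`), where a block contains at most `N ^ ε` grid times. -/

open scoped ENNReal

/-! ### Bounds on conditional expectations, tested against measurable functions. -/

section CondBound

variable {Ω : Type*} {m m' : MeasurableSpace Ω} {mΩ : MeasurableSpace Ω} {P : Measure Ω}

/-- The conditional expectation of `Y` given `m` is at most the constant `c`, expressed by testing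
against nonnegative `m`-measurable functions. -/
def CondBound (m : MeasurableSpace Ω) {mΩ : MeasurableSpace Ω} (P : Measure Ω)
    (Y : Ω → ℝ≥0∞) (c : ℝ≥0∞) : Prop :=
  ∀ g : Ω → ℝ≥0∞, Measurable[m] g → ∫⁻ ω, g ω * Y ω ∂P ≤ c * ∫⁻ ω, g ω ∂P

namespace CondBound

lemma const (hm : m ≤ mΩ) (c : ℝ≥0∞) :
    CondBound m P (fun _ => c) c := by
  intro g hg
  rw [lintegral_mul_const _ (hg.mono hm le_rfl), mul_comm]

lemma mono {Y Y' : Ω → ℝ≥0∞} {c c' : ℝ≥0∞} (h : CondBound m P Y c)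
    (hY : ∀ ω, Y' ω ≤ Y ω) (hc : c ≤ c') : CondBound m P Y' c' := by
  intro g hg
  calc ∫⁻ ω, g ω * Y' ω ∂P ≤ ∫⁻ ω, g ω * Y ω ∂P := by
        gcongr with ω; exact hY ω
    _ ≤ _ := (h g hg).trans (by gcongr)

lemma mono_left {Y : Ω → ℝ≥0∞} {c : ℝ≥0∞} (h : CondBound m P Y c)
    (hm : m' ≤ m) : CondBound m' P Y c :=
  fun g hg => h g (hg.mono hm le_rfl)

lemma add (hm : m ≤ mΩ) {Y Y' : Ω → ℝ≥0∞} {c c' : ℝ≥0∞}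
    (hY : Measurable Y) (h : CondBound m P Y c) (h' : CondBound m P Y' c') :
    CondBound m P (fun ω => Y ω + Y' ω) (c + c') := by
  intro g hg
  simp only [mul_add, add_mul]
  rw [lintegral_add_left (f := fun ω => g ω * Y ω) ((hg.mono hm le_rfl).mul hY)]
  exact add_le_add (h g hg) (h' g hg)

lemma sum {ι : Type*} (hm : m ≤ mΩ) (s : Finset ι) {Y : ι → Ω → ℝ≥0∞}
    {c : ι → ℝ≥0∞} (hY : ∀ i ∈ s, Measurable (Y i)) (h : ∀ i ∈ s, CondBound m P (Y i) (c i)) :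
    CondBound m P (fun ω => ∑ i ∈ s, Y i ω) (∑ i ∈ s, c i) := by
  intro g hg
  simp only [Finset.mul_sum, Finset.sum_mul]
  rw [lintegral_finsetSum (f := fun i ω => g ω * Y i ω) _ fun i hi => (hg.mono hm le_rfl).mul (hY i hi)]
  exact Finset.sum_le_sum fun i hi => h i hi g hg

lemma const_mul (hm : m ≤ mΩ) {Y : Ω → ℝ≥0∞} {c : ℝ≥0∞}
    (hY : Measurable Y) (h : CondBound m P Y c) (a : ℝ≥0∞) :
    CondBound m P (fun ω => a * Y ω) (a * c) := by
  intro g hg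
  have : ∀ ω, g ω * (a * Y ω) = a * (g ω * Y ω) := fun ω => by ring
  simp only [this]
  rw [lintegral_const_mul (f := fun ω => g ω * Y ω) _ ((hg.mono hm le_rfl).mul hY), mul_assoc]
  gcongr
  exact h g hg

/-- The tower property. -/
lemma mul (hmm : m ≤ m') {Y Y' : Ω → ℝ≥0∞} {c c' : ℝ≥0∞}
    (hY : Measurable[m'] Y) (h : CondBound m P Y c) (h' : CondBound m' P Y' c') :
    CondBound m P (fun ω => Y ω * Y' ω) (c * c') := by
  intro g hg
  calc ∫⁻ ω, g ω * (Y ω * Y' ω) ∂P = ∫⁻ ω, (g ω * Y ω) * Y' ω ∂P := by simp only [mul_assoc]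
    _ ≤ c' * ∫⁻ ω, g ω * Y ω ∂P := h' _ ((hg.mono hmm le_rfl).mul hY)
    _ ≤ c' * (c * ∫⁻ ω, g ω ∂P) := by gcongr; exact h g hg
    _ = _ := by ring

lemma lintegral_le [IsProbabilityMeasure P] {Y : Ω → ℝ≥0∞} {c : ℝ≥0∞}
    (h : CondBound m P Y c) : ∫⁻ ω, Y ω ∂P ≤ c := by
  simpa using h (fun _ => 1) measurable_const

/-- If `X` is `m`-measurable and `Z` is independent of `m`, then a bound on the probability of
`(x, Z) ∈ S` that is uniform in `x` bounds the conditional probability of `(X, Z) ∈ S`. -/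
lemma of_indep [IsProbabilityMeasure P] (hm : m ≤ mΩ)
    {α β : Type*} [MeasurableSpace α]
    [MeasurableSpace β] {X : Ω → α} {Z : Ω → β} (hX : Measurable[m] X) (hZ : Measurable Z)
    (hind : Indep m (MeasurableSpace.comap Z inferInstance) P) {S : Set (α × β)}
    (hS : MeasurableSet S) {c : ℝ≥0∞} (hc : ∀ x, P {ω | (x, Z ω) ∈ S} ≤ c) :
    CondBound m P ({ω | (X ω, Z ω) ∈ S}.indicator 1) c := by
  intro g hg
  -- The test function is bundled with `X`: the pair is independent of `Z`, so Fubini lets the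
  -- uniform bound be applied for each fixed value of the pair.
  have hgX : Measurable[m] fun ω => (g ω, X ω) := Measurable.prodMk (m := m) hg hX
  have hgX' : Measurable fun ω => (g ω, X ω) := hgX.mono hm le_rfl
  have hI : IndepFun (fun ω => (g ω, X ω)) Z P := by
    rw [IndepFun_iff_Indep]
    exact indep_of_indep_of_le_left hind hgX.comap_le
  have hmap := (indepFun_iff_map_prod_eq_prod_map_map hgX'.aemeasurable hZ.aemeasurable).1 hI
  have := Measure.isProbabilityMeasure_map (μ := P) hZ.aemeasurable
  have := Measure.isProbabilityMeasure_map (μ := P) hgX'.aemeasurable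
  set F : (ℝ≥0∞ × α) × β → ℝ≥0∞ := fun q => q.1.1 * S.indicator 1 (q.1.2, q.2) with hF
  have hFm : Measurable F := by
    refine (measurable_fst.comp measurable_fst).mul ?_
    exact (measurable_one.indicator hS).comp (by fun_prop)
  have e1 : ∫⁻ ω, g ω * ({ω | (X ω, Z ω) ∈ S}.indicator 1) ω ∂P
      = ∫⁻ q, F q ∂(P.map fun ω => ((g ω, X ω), Z ω)) := by
    rw [lintegral_map hFm (hgX'.prodMk hZ)]
    rfl
  rw [e1, hmap, lintegral_prod _ hFm.aemeasurable]
  calc ∫⁻ q, ∫⁻ z, F (q, z) ∂(P.map Z) ∂(P.map fun ω => (g ω, X ω))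
      ≤ ∫⁻ q, q.1 * c ∂(P.map fun ω => (g ω, X ω)) := by
        refine lintegral_mono fun q => ?_
        simp only [hF]
        have hSq : MeasurableSet {z | (q.2, z) ∈ S} := hS.preimage measurable_prodMk_left
        rw [lintegral_const_mul (f := fun z => S.indicator 1 (q.2, z)) _
          ((measurable_one.indicator hS).comp (by fun_prop))]
        gcongr
        refine le_trans (le_of_eq ?_) (hc q.2)
        have : ∀ z, S.indicator (1 : α × β → ℝ≥0∞) (q.2, z)
            = {z | (q.2, z) ∈ S}.indicator 1 z := fun z => rfl
        simp only [this]
        rw [lintegral_indicator_one hSq, Measure.map_apply hZ hSq]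
        rfl
    _ = _ := by
        rw [lintegral_map (by fun_prop) hgX', lintegral_mul_const _ (hg.mono hm le_rfl), mul_comm]

end CondBound

end CondBound

/-! ### Gaussian small-ball and tail estimates. -/

section GaussianBounds

lemma gaussianReal_ball_le {v : ℝ≥0} (hv : v ≠ 0) (x b : ℝ) (hb : 0 ≤ b) :
    gaussianReal 0 v {z | |z - x| ≤ b} ≤ ENNReal.ofReal (b / √v) := by
  have hv0 : (0 : ℝ) < v := by positivity
  rw [gaussianReal_apply 0 hv]
  have hpdf : ∀ z, gaussianPDF 0 v z ≤ ENNReal.ofReal ((√(2 * Real.pi * v))⁻¹) := by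
    intro z
    rw [gaussianPDF]
    refine ENNReal.ofReal_le_ofReal ?_
    rw [gaussianPDFReal]
    refine mul_le_of_le_one_right (by positivity) ?_
    rw [Real.exp_le_one_iff]
    rw [neg_div]
    have : 0 ≤ (z - 0) ^ 2 / (2 * (v : ℝ)) := by positivity
    linarith
  calc ∫⁻ z in {z | |z - x| ≤ b}, gaussianPDF 0 v z
      ≤ ∫⁻ _ in {z | |z - x| ≤ b}, ENNReal.ofReal ((√(2 * Real.pi * v))⁻¹) :=
        lintegral_mono fun z => hpdf z
    _ = ENNReal.ofReal ((√(2 * Real.pi * v))⁻¹ * (2 * b)) := by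
        rw [setLIntegral_const]
        have : {z | |z - x| ≤ b} = Metric.closedBall x b := by
          ext z; simp [Real.dist_eq]
        rw [this, Real.volume_closedBall, ← ENNReal.ofReal_mul (by positivity)]
    _ ≤ _ := by
        refine ENNReal.ofReal_le_ofReal ?_
        have h4 : 2 * √v ≤ √(2 * Real.pi * v) := by
          rw [show (2 : ℝ) * √v = √(4 * v) by
            rw [Real.sqrt_mul (by norm_num), show (4 : ℝ) = 2 ^ 2 by norm_num,
              Real.sqrt_sq (by norm_num)]]
          refine Real.sqrt_le_sqrt ?_
          have := Real.pi_gt_three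
          nlinarith
        have hs : 0 < √(v : ℝ) := Real.sqrt_pos.2 hv0
        rw [inv_mul_eq_div, div_le_div_iff₀ (by positivity) hs]
        nlinarith

/-- Chernoff's bound with parameter `a / v'` on each side. The majorant `v'` gives one bound for all
times up to `v'`, including the degenerate variance `0`. -/
lemma gaussianReal_tail_le {v : ℝ≥0} {v' a : ℝ} (hv' : 0 < v') (hvv : v ≤ v') (ha : 0 ≤ a) :
    gaussianReal 0 v {z | a < |z|} ≤ ENNReal.ofReal (2 * Real.exp (-(a ^ 2 / (2 * v')))) := by
  have hmgf := @mgf_id_gaussianReal 0 v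
  have key : ∀ t : ℝ, mgf id (gaussianReal 0 v) t = Real.exp (v * t ^ 2 / 2) := by
    intro t; rw [hmgf]; simp
  have hbound : Real.exp (-(a / v') * a) * Real.exp (v * (a / v') ^ 2 / 2)
      ≤ Real.exp (-(a ^ 2 / (2 * v'))) := by
    rw [← Real.exp_add]
    refine Real.exp_le_exp.2 ?_
    have : v * (a / v') ^ 2 / 2 ≤ v' * (a / v') ^ 2 / 2 := by gcongr
    calc -(a / v') * a + v * (a / v') ^ 2 / 2 ≤ -(a / v') * a + v' * (a / v') ^ 2 / 2 := by linarith
      _ = _ := by field_simp; ring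
  have h1 := measure_ge_le_exp_mul_mgf (μ := gaussianReal 0 v) (X := id) (t := a / v') a
    (by positivity) (integrable_exp_mul_gaussianReal _)
  have h2 := measure_le_le_exp_mul_mgf (μ := gaussianReal 0 v) (X := id) (t := -(a / v')) (-a)
    (by have : 0 ≤ a / v' := by positivity
        linarith) (integrable_exp_mul_gaussianReal _)
  rw [key] at h1 h2
  have h2' : (gaussianReal 0 v).real {ω | id ω ≤ -a}
      ≤ Real.exp (-(a / v') * a) * Real.exp (v * (a / v') ^ 2 / 2) := by
    convert h2 using 3 <;> ring
  have hsub : {z : ℝ | a < |z|} ⊆ {ω | a ≤ id ω} ∪ {ω | id ω ≤ -a} := by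
    intro z hz
    rcases lt_abs.1 (show a < |z| from hz) with h | h
    · exact Or.inl h.le
    · exact Or.inr (by simp only [id, Set.mem_ofPred_eq]; linarith)
  have h3 : (gaussianReal 0 v).real {z | a < |z|} ≤ 2 * Real.exp (-(a ^ 2 / (2 * v'))) :=
    calc _ ≤ _ := measureReal_mono hsub
      _ ≤ _ := measureReal_union_le _ _
      _ ≤ _ := by linarith
  rw [← ofReal_measureReal]
  exact ENNReal.ofReal_le_ofReal h3

end GaussianBounds

/-! ### Markov property and hitting probabilities of Brownian motion. -/

section Brownian

variable {Ω : Type*} {mΩ : MeasurableSpace Ω} {P : Measure Ω} {B : ℝ≥0 → Ω → ℝ}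

/-- The `σ`-algebra generated by the process `B` up to time `s`. -/
abbrev pastSigma (B : ℝ≥0 → Ω → ℝ) (s : ℝ≥0) : MeasurableSpace Ω :=
  MeasurableSpace.comap (fun ω (t : Set.Iic s) => B t ω) MeasurableSpace.pi

lemma pastSigma_le (hm : ∀ t, Measurable (B t)) (s : ℝ≥0) : pastSigma B s ≤ mΩ :=
  (measurable_pi_lambda _ fun t : Set.Iic s => hm t).comap_le

lemma measurable_pastSigma {s t : ℝ≥0} (hts : t ≤ s) : Measurable[pastSigma B s] (B t) := by
  have h : Measurable[pastSigma B s] (fun ω (t : Set.Iic s) => B t ω) :=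
    comap_measurable _
  exact (measurable_pi_apply (⟨t, hts⟩ : Set.Iic s)).comp h

lemma pastSigma_mono {s t : ℝ≥0} (hst : s ≤ t) : pastSigma B s ≤ pastSigma B t := by
  refine Measurable.comap_le ?_
  exact @measurable_pi_lambda _ _ _ (pastSigma B t) _ _
    fun u : Set.Iic s => measurable_pastSigma (le_trans u.2 hst)

lemma indep_pastSigma (hB : IsPreBrownianReal B P) (s : ℝ≥0) :
    Indep (pastSigma B s)
      (MeasurableSpace.comap (fun ω t => B (s + t) ω - B s ω) inferInstance) P := by
  have := hB.indepFun_shift s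
  rw [IndepFun_iff_Indep] at this
  exact this.symm

lemma measure_increment_mem (hB : IsPreBrownianReal B P) (s u : ℝ≥0) {S : Set ℝ} (hS : MeasurableSet S) :
    P {ω | B (s + u) ω - B s ω ∈ S} = gaussianReal 0 u S := by
  have h := hB.hasLaw_sub (s + u) s
  have hv : nndist (s + u).1 s.1 = u := by
    ext
    simp
  rw [hv] at h
  rw [← h.map_eq, Measure.map_apply_of_aemeasurable h.aemeasurable hS]
  rfl

/-- The probability of a Brownian motion being near a given level, given the past. -/
lemma condBound_near (hB : IsPreBrownianReal B P) (hm : ∀ t, Measurable (B t))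
    [IsProbabilityMeasure P] {s u : ℝ≥0} (hu : u ≠ 0) (x b : ℝ) (hb : 0 ≤ b) :
    CondBound (pastSigma B s) P ({ω | |B (s + u) ω - x| ≤ b}.indicator 1)
      (ENNReal.ofReal (b / √u)) := by
  have hZ : Measurable fun ω (t : ℝ≥0) => B (s + t) ω - B s ω :=
    measurable_pi_lambda _ fun t => (hm _).sub (hm _)
  have hS : MeasurableSet {q : ℝ × (ℝ≥0 → ℝ) | |q.1 + q.2 u - x| ≤ b} :=
    measurableSet_le (by fun_prop) (by fun_prop)
  have := CondBound.of_indep (pastSigma_le hm s) (measurable_pastSigma (B := B) le_rfl) hZ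
    (indep_pastSigma hB s) hS (c := ENNReal.ofReal (b / √u)) (fun y => by
      have hSm : MeasurableSet {z : ℝ | |z - (x - y)| ≤ b} :=
        measurableSet_le (by fun_prop) (by fun_prop)
      refine le_trans (le_of_eq ?_) (gaussianReal_ball_le hu (x - y) b hb)
      rw [← measure_increment_mem hB s u hSm]
      congr 1
      ext ω
      simp only [Set.mem_ofPred_eq]
      rw [show y + (B (s + u) ω - B s ω) - x = B (s + u) ω - B s ω - (x - y) by ring])
  convert this using 2
  ext ω
  simp

/-- The probability of a large increment at one of finitely many times, given the past. -/
lemma condBound_increment (hB : IsPreBrownianReal B P) (hm : ∀ t, Measurable (B t))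
    [IsProbabilityMeasure P] (s : ℝ≥0) (T : Finset ℝ≥0) {v a : ℝ} (hv : 0 < v) (ha : 0 ≤ a)
    (hT : ∀ u ∈ T, (u : ℝ) ≤ v) :
    CondBound (pastSigma B s) P ({ω | ∃ u ∈ T, a < |B (s + u) ω - B s ω|}.indicator 1)
      (T.card * ENNReal.ofReal (2 * Real.exp (-(a ^ 2 / (2 * v))))) := by
  have hZ : Measurable fun ω (t : ℝ≥0) => B (s + t) ω - B s ω :=
    measurable_pi_lambda _ fun t => (hm _).sub (hm _)
  have hS : MeasurableSet {q : ℝ × (ℝ≥0 → ℝ) | ∃ u ∈ T, a < |q.2 u|} := by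
    have : {q : ℝ × (ℝ≥0 → ℝ) | ∃ u ∈ T, a < |q.2 u|}
        = ⋃ u ∈ T, {q : ℝ × (ℝ≥0 → ℝ) | a < |q.2 u|} := by
      ext q; simp
    rw [this]
    exact T.measurableSet_biUnion fun u _ => measurableSet_lt (by fun_prop) (by fun_prop)
  refine CondBound.of_indep (pastSigma_le hm s) (measurable_pastSigma (B := B) le_rfl) hZ
    (indep_pastSigma hB s) hS (fun y => ?_)
  have hSm : MeasurableSet {z : ℝ | a < |z|} := measurableSet_lt (by fun_prop) (by fun_prop)
  have hun : {ω | (y, fun t => B (s + t) ω - B s ω) ∈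
      {q : ℝ × (ℝ≥0 → ℝ) | ∃ u ∈ T, a < |q.2 u|}}
      = ⋃ u ∈ T, {ω | B (s + u) ω - B s ω ∈ {z : ℝ | a < |z|}} := by
    ext ω; simp
  rw [hun]
  refine (measure_biUnion_finset_le _ _).trans ?_
  rw [← nsmul_eq_mul]
  refine Finset.sum_le_card_nsmul _ _ _ fun u hu => ?_
  rw [measure_increment_mem hB s u hSm]
  exact gaussianReal_tail_le hv (hT u hu) ha

/-- The event that `B` comes within `ρ` of `x` at one of the times `l / N`, `k L ≤ l < (k + 1) L`. -/
def blockHit (B : ℝ≥0 → Ω → ℝ) (N L : ℕ) (ρ : ℝ) (k : ℕ) (x : ℝ) : Set Ω :=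
  {ω | ∃ l ∈ Finset.Ico (k * L) ((k + 1) * L), |B ((l : ℝ≥0) / N) ω - x| ≤ ρ}

lemma measurableSet_blockHit_pastSigma (N L : ℕ) (ρ : ℝ) (k : ℕ) (x : ℝ) :
    MeasurableSet[pastSigma B (((k + 1) * L : ℕ) / N)] (blockHit B N L ρ k x) := by
  have : blockHit B N L ρ k x = ⋃ l ∈ Finset.Ico (k * L) ((k + 1) * L),
      {ω | |B ((l : ℝ≥0) / N) ω - x| ≤ ρ} := by
    ext ω; simp [blockHit]
  rw [this]
  refine Finset.measurableSet_biUnion _ fun l hl => ?_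
  have hb : Measurable[pastSigma B (((k + 1) * L : ℕ) / N)] (B ((l : ℝ≥0) / N)) := by
    refine measurable_pastSigma ?_
    gcongr
    exact (Finset.mem_Ico.1 hl).2.le
  have hset : MeasurableSet {y : ℝ | |y - x| ≤ ρ} :=
    measurableSet_le (by fun_prop) (by fun_prop)
  exact hb hset

/-- The conditional probability that a block is hit, given the past up to an earlier block. -/
lemma condBound_blockHit (hB : IsPreBrownianReal B P) (hm : ∀ t, Measurable (B t))
    [IsProbabilityMeasure P] {N L i k : ℕ} (hN : 0 < N) (hL : 0 < L) (hik : i < k)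
    {ρ a : ℝ} (hρ : 0 ≤ ρ) (ha : 0 ≤ a) (x : ℝ) :
    CondBound (pastSigma B ((i * L : ℕ) / N)) P ((blockHit B N L ρ k x).indicator 1)
      (ENNReal.ofReal ((ρ + a) / √((k - i : ℕ) * L / N)
        + L * (2 * Real.exp (-(a ^ 2 / (2 * (L / N))))))) := by
  have hNp : (0 : ℝ) < N := by exact_mod_cast hN
  have hNp' : (0 : ℝ≥0) < N := by exact_mod_cast hN
  have hLp : (0 : ℝ) < L := by exact_mod_cast hL
  set s : ℝ≥0 := (i * L : ℕ) / N with hs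
  set t : ℝ≥0 := (k * L : ℕ) / N with ht
  set u : ℝ≥0 := ((k - i) * L : ℕ) / N with hu
  have hst : s + u = t := by
    rw [hs, hu, ht, ← add_div, ← Nat.cast_add, ← add_mul]
    congr 3
    omega
  have hu0 : u ≠ 0 := by
    rw [hu]
    have : 0 < (k - i) * L := Nat.mul_pos (by omega) hL
    positivity
  -- A hit during block `k` forces either `B` to be within `ρ + a` of `x` at the initial time `t` of
  -- the block, or an increment larger than `a` inside the block. The second event is bounded given
  -- the past of `t`, hence also given the smaller past of `s`.
  have h1 := condBound_near hB hm (s := s) hu0 x (ρ + a) (by positivity)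
  set T : Finset ℝ≥0 := (Finset.range L).image fun j : ℕ => (j : ℝ≥0) / N with hT
  have h2 := (condBound_increment hB hm t T (v := L / N) (a := a) (by positivity) ha (by
    intro v hv
    obtain ⟨j, hj, rfl⟩ := Finset.mem_image.1 hv
    have : (j : ℝ) ≤ L := by exact_mod_cast (Finset.mem_range.1 hj).le
    push_cast
    gcongr)).mono_left (pastSigma_mono (B := B) (s := s) (t := t) (by rw [← hst]; simp))
  rw [hst] at h1
  have hmeas : Measurable ({ω | |B t ω - x| ≤ ρ + a}.indicator (1 : Ω → ℝ≥0∞)) :=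
    measurable_one.indicator (measurableSet_le (by have := hm t; fun_prop) (by fun_prop))
  refine ((h1.add (pastSigma_le hm s) hmeas h2)).mono (fun ω => ?_) ?_
  · by_cases hω : ω ∈ blockHit B N L ρ k x
    · obtain ⟨l, hl, hlx⟩ := hω
      rw [Finset.mem_Ico] at hl
      by_cases hA : |B t ω - x| ≤ ρ + a
      · rw [Set.indicator_of_mem (show ω ∈ {ω | |B t ω - x| ≤ ρ + a} from hA)]
        exact le_add_right (Set.indicator_le_self _ _ _)
      · have hA2 : ω ∈ {ω | ∃ u ∈ T, a < |B (t + u) ω - B t ω|} := by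
          refine ⟨((l - k * L : ℕ) : ℝ≥0) / N, Finset.mem_image.2 ⟨l - k * L, ?_, rfl⟩, ?_⟩
          · rw [Finset.mem_range]
            have : (k + 1) * L = k * L + L := by ring
            omega
          · have : t + ((l - k * L : ℕ) : ℝ≥0) / N = l / N := by
              rw [ht, ← add_div, ← Nat.cast_add]
              congr 2
              omega
            rw [this]
            push Not at hA
            have h3 : |B t ω - x| ≤ |B (l / N) ω - x| + |B (l / N) ω - B t ω| := by
              have := abs_sub_le (B t ω) (B (l / N) ω) x
              rw [abs_sub_comm (B t ω) (B (l / N) ω)] at this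
              linarith
            linarith
        rw [Set.indicator_of_mem hA2]
        exact le_add_left (Set.indicator_le_self _ _ _)
    · rw [Set.indicator_of_notMem hω]
      exact zero_le
  · rw [ENNReal.ofReal_add (by positivity) (by positivity)]
    refine add_le_add (le_of_eq ?_) ?_
    · congr 3
      rw [hu]
      simp only [NNReal.coe_div, NNReal.coe_mul, NNReal.coe_natCast, Nat.cast_mul]
    · rw [ENNReal.ofReal_mul (p := (L : ℝ)) (by positivity), ENNReal.ofReal_natCast]
      gcongr
      rw [hT]
      exact Finset.card_image_le.trans (by simp)

end Brownian

/-! ### Exponential moments of hit counts. -/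

section ExponentialMoment

variable {Ω : Type*} {mΩ : MeasurableSpace Ω} {P : Measure Ω}

/-- Expansion of a product of `1 + a j` according to the first index where `a j` is selected. -/
lemma prod_one_add_eq_first {R : Type*} [CommSemiring R] (a : ℕ → R) (n i : ℕ) :
    ∏ j ∈ Finset.range n, (1 + a (i + j)) = 1 + ∑ j ∈ Finset.range n,
      a (i + j) * ∏ l ∈ Finset.range (n - (j + 1)), (1 + a (i + j + 1 + l)) := by
  induction n generalizing i with
  | zero => simp
  | succ n ih =>
    rw [Finset.prod_range_succ', Finset.sum_range_succ']
    have h1 : ∏ k ∈ Finset.range n, (1 + a (i + (k + 1)))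
        = ∏ k ∈ Finset.range n, (1 + a (i + 1 + k)) :=
      Finset.prod_congr rfl fun k _ => by rw [show i + (k + 1) = i + 1 + k by ring]
    have h2 : ∑ j ∈ Finset.range n, a (i + (j + 1)) *
          ∏ l ∈ Finset.range (n + 1 - (j + 1 + 1)), (1 + a (i + (j + 1) + 1 + l))
        = ∑ j ∈ Finset.range n, a (i + 1 + j) *
          ∏ l ∈ Finset.range (n - (j + 1)), (1 + a (i + 1 + j + 1 + l)) :=
      Finset.sum_congr rfl fun k _ => by
        rw [show i + (k + 1) = i + 1 + k by ring, show n + 1 - (k + 1 + 1) = n - (k + 1) by omega]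
    rw [h1, h2, mul_add, mul_one]
    nth_rewrite 1 [ih (i + 1)]
    simp only [add_zero, Nat.add_sub_cancel, zero_add]
    ring

variable {F : ℕ → MeasurableSpace Ω} {H : ℕ → Set Ω} {p : ℕ → ℝ≥0∞}

lemma measurable_prod_one_add (hFm : Monotone F) (hH : ∀ k, MeasurableSet[F (k + 1)] (H k))
    (β : ℝ≥0∞) (i n : ℕ) :
    Measurable[F (i + n)] fun ω =>
      ∏ j ∈ Finset.range n, (1 + β * (H (i + j)).indicator 1 ω) := by
  refine Finset.measurable_prod (m := F (i + n)) _ fun j hj => ?_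
  have : MeasurableSet[F (i + n)] (H (i + j)) :=
    hFm (by have := Finset.mem_range.1 hj; omega) _ (hH (i + j))
  exact (Measurable.const_mul ((@measurable_const ℝ≥0∞ Ω _ (F (i + n)) 1).indicator this) β).const_add 1

/-- Expand by the first selected hit. Given the past up to that hit, the remaining product has mean
at most 2 by induction, so the whole has mean at most `1 + 2 * β * ∑ p d`, and the choice of `β`
closes the induction. -/
lemma condBound_prod_one_add [IsProbabilityMeasure P] (hF : ∀ k, F k ≤ mΩ) (hFm : Monotone F)
    (hH : ∀ k, MeasurableSet[F (k + 1)] (H k))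
    (hp : ∀ i k, i ≤ k → CondBound (F i) P ((H k).indicator 1) (p (k - i)))
    {β : ℝ≥0∞} {M : ℕ} (hβ : β * (2 * ∑ d ∈ Finset.range M, p d) ≤ 1) {n : ℕ} (hn : n ≤ M)
    (i : ℕ) :
    CondBound (F i) P (fun ω => ∏ j ∈ Finset.range n, (1 + β * (H (i + j)).indicator 1 ω)) 2 := by
  induction n using Nat.strong_induction_on generalizing i with
  | _ n ih =>
    have hprod : ∀ i n, Measurable fun ω =>
        ∏ j ∈ Finset.range n, (1 + β * (H (i + j)).indicator 1 ω) := fun i n =>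
      (measurable_prod_one_add hFm hH β i n).mono (hF _) le_rfl
    have hind : ∀ k, Measurable[F (k + 1)] ((H k).indicator (1 : Ω → ℝ≥0∞)) := fun k =>
      (@measurable_const ℝ≥0∞ Ω _ (F (k + 1)) 1).indicator (hH k)
    have hterm : ∀ j ∈ Finset.range n, CondBound (F i) P
        (fun ω => β * ((H (i + j)).indicator 1 ω *
          ∏ l ∈ Finset.range (n - (j + 1)), (1 + β * (H (i + j + 1 + l)).indicator 1 ω)))
        (β * (p j * 2)) := by
      intro j hj
      have hj' := Finset.mem_range.1 hj
      refine CondBound.const_mul (hF i) (((hind (i + j)).mono (hF _) le_rfl).mul (hprod _ _)) ?_ β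
      refine CondBound.mul (hFm (by omega : i ≤ i + j + 1)) (hind (i + j)) ?_
        (ih (n - (j + 1)) (by omega) (by omega) (i + j + 1))
      simpa using hp i (i + j) (by omega)
    have hsum := CondBound.sum (hF i) (Finset.range n) (fun j _ =>
      Measurable.const_mul (((hind (i + j)).mono (hF _) le_rfl).mul (hprod _ _)) β) hterm
    have := CondBound.add (hF i) measurable_const (CondBound.const (P := P) (hF i) 1) hsum
    refine this.mono (fun ω => le_of_eq ?_) ?_
    · rw [prod_one_add_eq_first (fun k => β * (H k).indicator 1 ω)]
      simp only [mul_assoc, Pi.mul_apply]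
    · calc 1 + ∑ j ∈ Finset.range n, β * (p j * 2)
          = 1 + β * (2 * ∑ j ∈ Finset.range n, p j) := by
            rw [← Finset.mul_sum, ← Finset.sum_mul, mul_comm 2]
        _ ≤ 1 + β * (2 * ∑ j ∈ Finset.range M, p j) := by gcongr
        _ ≤ 1 + 1 := by gcongr
        _ = 2 := one_add_one_eq_two

/-- The generating function of the numbers of hits `H x k` in the blocks
`{I * M, …, I * M + M - 1}`. -/
noncomputable def blockGen {Ω ι : Type*} (H : ι → ℕ → Set Ω) (X : Finset ι) (β γ : ℝ≥0∞) (M : ℕ)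
    (I : ℕ) (ω : Ω) : ℝ≥0∞ :=
  1 + γ * ∑ x ∈ X, ∏ j ∈ Finset.range M, (1 + β * (H x (I * M + j)).indicator 1 ω)

variable {ι : Type*} {H : ι → ℕ → Set Ω}

lemma measurable_blockGen (hFm : Monotone F) (hH : ∀ x k, MeasurableSet[F (k + 1)] (H x k))
    (X : Finset ι) (β γ : ℝ≥0∞) (M I : ℕ) :
    Measurable[F ((I + 1) * M)] (blockGen H X β γ M I) := by
  have hs : Measurable[F ((I + 1) * M)] fun ω =>
      ∑ x ∈ X, ∏ j ∈ Finset.range M, (1 + β * (H x (I * M + j)).indicator 1 ω) := by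
    refine Finset.measurable_sum (m := F ((I + 1) * M)) _ fun x _ => ?_
    rw [add_mul, one_mul]
    exact measurable_prod_one_add hFm (hH x) β (I * M) M
  exact (Measurable.const_mul hs γ).const_add 1

lemma condBound_blockGen_prod [IsProbabilityMeasure P] (hF : ∀ k, F k ≤ mΩ) (hFm : Monotone F)
    (hH : ∀ x k, MeasurableSet[F (k + 1)] (H x k))
    (hp : ∀ x i k, i ≤ k → CondBound (F i) P ((H x k).indicator 1) (p (k - i)))
    {β : ℝ≥0∞} {M : ℕ} (hβ : β * (2 * ∑ d ∈ Finset.range M, p d) ≤ 1) (X : Finset ι) (γ : ℝ≥0∞)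
    (n I : ℕ) :
    CondBound (F (I * M)) P (fun ω => ∏ m ∈ Finset.range n, blockGen H X β γ M (I + m) ω)
      ((1 + γ * (X.card * 2)) ^ n) := by
  induction n generalizing I with
  | zero => simpa using CondBound.const (P := P) (hF (I * M)) 1
  | succ n ih =>
    have hfac : CondBound (F (I * M)) P (blockGen H X β γ M I) (1 + γ * (X.card * 2)) := by
      have hm : ∀ x ∈ X, Measurable fun ω =>
          ∏ j ∈ Finset.range M, (1 + β * (H x (I * M + j)).indicator 1 ω) := fun x _ =>
        (measurable_prod_one_add hFm (hH x) β (I * M) M).mono (hF _) le_rfl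
      have h1 := CondBound.sum (P := P) (hF (I * M)) X hm (fun x _ =>
        condBound_prod_one_add hF hFm (hH x) (hp x) hβ le_rfl (I * M))
      have h2 := h1.const_mul (hF (I * M)) (Finset.measurable_sum _ hm) γ
      have h3 := CondBound.add (hF (I * M)) measurable_const
        (CondBound.const (P := P) (hF (I * M)) 1) h2
      refine h3.mono (fun ω => le_rfl) (le_of_eq ?_)
      rw [Finset.sum_const, nsmul_eq_mul]
    have := CondBound.mul (hFm (Nat.mul_le_mul_right M (Nat.le_succ I)))
      (measurable_blockGen hFm hH X β γ M I) hfac (ih (I + 1))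
    refine this.mono (fun ω => le_of_eq ?_) (le_of_eq (pow_succ' _ _).symm)
    rw [Finset.prod_range_succ', mul_comm]
    simp only [add_zero]
    congr 1
    exact Finset.prod_congr rfl fun k _ => by rw [show I + (k + 1) = I + 1 + k by ring]

open Classical in
-- In each factor with `I ∈ A` keep only the `γ`-term of label `x I`; the other factors are at least
-- 1. A single random variable thus dominates all choices of `A` and `x`, so no union bound is
-- needed.
lemma le_prod_blockGen (X : Finset ι) (β γ : ℝ≥0∞) (M n : ℕ) (ω : Ω) {A : Finset ℕ}
    (hA : A ⊆ Finset.range n) {x : ℕ → ι} (hx : ∀ I ∈ A, x I ∈ X) :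
    γ ^ A.card * (1 + β) ^ (∑ I ∈ A,
      ((Finset.range M).filter fun j => ω ∈ H (x I) (I * M + j)).card)
      ≤ ∏ m ∈ Finset.range n, blockGen H X β γ M m ω := by
  calc _ = ∏ I ∈ A, γ * (1 + β) ^
        ((Finset.range M).filter fun j => ω ∈ H (x I) (I * M + j)).card := by
        rw [Finset.prod_mul_distrib, Finset.prod_const, Finset.prod_pow_eq_pow_sum]
    _ ≤ ∏ I ∈ A, blockGen H X β γ M I ω := by
        refine Finset.prod_le_prod' fun I hI => ?_
        have h1 : (1 + β) ^ ((Finset.range M).filter fun j => ω ∈ H (x I) (I * M + j)).card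
            = ∏ j ∈ Finset.range M, (1 + β * (H (x I) (I * M + j)).indicator 1 ω) := by
          rw [← Finset.prod_const, Finset.prod_filter]
          refine Finset.prod_congr rfl fun j _ => ?_
          by_cases h : ω ∈ H (x I) (I * M + j) <;> simp [h]
        rw [h1]
        refine le_add_left ?_
        gcongr
        exact Finset.single_le_sum
          (f := fun x => ∏ j ∈ Finset.range M, (1 + β * (H x (I * M + j)).indicator 1 ω))
          (fun _ _ => zero_le) (hx I hI)
    _ ≤ _ := Finset.prod_le_prod_of_subset_of_one_le' hA fun _ _ _ => le_self_add

open Classical in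
/-- Outside an event of probability at most `exp (1 - Y)`, for any choice of blocks `I ∈ A` and of
labels `x I`, the total number of hits in these blocks is at most of the order of
`q (Y + A.card log)`, where `q` bounds the conditional mean number of hits in a block. -/
lemma exists_event_total_hits_le [IsProbabilityMeasure P] (hF : ∀ k, F k ≤ mΩ) (hFm : Monotone F)
    (hH : ∀ x k, MeasurableSet[F (k + 1)] (H x k))
    (hp : ∀ x i k, i ≤ k → CondBound (F i) P ((H x k).indicator 1) (p (k - i)))
    {M : ℕ} {q : ℝ} (hq : 1 ≤ q) (hpq : ∑ d ∈ Finset.range M, p d ≤ ENNReal.ofReal q)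
    {X : Finset ι} (hX : X.Nonempty) {n : ℕ} (hn : 0 < n) (Y : ℝ) :
    ∃ D : Set Ω, P D ≤ ENNReal.ofReal (Real.exp (1 - Y)) ∧ ∀ ω ∉ D, ∀ A ⊆ Finset.range n,
      ∀ x : ℕ → ι, (∀ I ∈ A, x I ∈ X) →
        ((∑ I ∈ A, ((Finset.range M).filter fun j => ω ∈ H (x I) (I * M + j)).card : ℕ) : ℝ)
          ≤ 4 * q * (Y + A.card * Real.log (2 * X.card * n)) := by
  have hXc : (0 : ℝ) < X.card := by exact_mod_cast hX.card_pos
  have hnp : (0 : ℝ) < n := by exact_mod_cast hn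
  -- `β` is as large as the moment bound 2 for a single block and label permits; `γ` makes each
  -- factor of the product have conditional mean at most `1 + 1 / n`, so that `n` of them cost at
  -- most `e`.
  set β : ℝ := 1 / (2 * q) with hβ
  set γ : ℝ := 1 / (2 * X.card * n) with hγ
  have hβ0 : 0 < β := by positivity
  have hγ0 : 0 < γ := by positivity
  have hβq : ENNReal.ofReal β * (2 * ∑ d ∈ Finset.range M, p d) ≤ 1 := by
    calc _ ≤ ENNReal.ofReal β * (2 * ENNReal.ofReal q) := by gcongr
      _ = ENNReal.ofReal (β * (2 * q)) := by
        rw [ENNReal.ofReal_mul hβ0.le, ENNReal.ofReal_mul zero_le_two, ENNReal.ofReal_ofNat]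
      _ = 1 := by
        rw [hβ, one_div, inv_mul_cancel₀ (by positivity), ENNReal.ofReal_one]
  set V : Ω → ℝ≥0∞ := fun ω =>
    ∏ m ∈ Finset.range n, blockGen H X (ENNReal.ofReal β) (ENNReal.ofReal γ) M m ω with hV
  have hVm : Measurable V := Finset.measurable_prod _ fun m _ =>
    (measurable_blockGen hFm hH X _ _ M m).mono (hF _) le_rfl
  have hVint : ∫⁻ ω, V ω ∂P ≤ ENNReal.ofReal (Real.exp 1) := by
    have h := (condBound_blockGen_prod (P := P) hF hFm hH hp hβq X (ENNReal.ofReal γ) n 0).lintegral_le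
    simp only [zero_add] at h
    refine h.trans ?_
    have h1 : 1 + ENNReal.ofReal γ * (X.card * 2) = ENNReal.ofReal (1 + 1 / n) := by
      rw [ENNReal.ofReal_add zero_le_one (by positivity), ENNReal.ofReal_one]
      congr 1
      rw [← ENNReal.ofReal_natCast, ← ENNReal.ofReal_ofNat, ← ENNReal.ofReal_mul (by positivity),
        ← ENNReal.ofReal_mul (by positivity)]
      congr 1
      rw [hγ]
      field_simp
    rw [h1, ← ENNReal.ofReal_pow (by positivity)]
    refine ENNReal.ofReal_le_ofReal ?_
    calc (1 + 1 / (n : ℝ)) ^ n ≤ (Real.exp (1 / n)) ^ n := by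
          gcongr
          rw [add_comm]
          exact Real.add_one_le_exp _
      _ = Real.exp 1 := by
          rw [← Real.exp_nat_mul]
          congr 1
          field_simp
  refine ⟨{ω | ENNReal.ofReal (Real.exp Y) ≤ V ω}, ?_, ?_⟩
  · refine (meas_ge_le_lintegral_div hVm.aemeasurable (by simp [Real.exp_pos])
      ENNReal.ofReal_ne_top).trans ?_
    rw [Real.exp_sub, ENNReal.ofReal_div_of_pos (Real.exp_pos _)]
    gcongr
  · intro ω hω A hA x hx
    have hω' : V ω < ENNReal.ofReal (Real.exp Y) := not_le.1 hω
    have hlow := le_prod_blockGen (H := H) X (ENNReal.ofReal β) (ENNReal.ofReal γ) M n ω hA hx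
    set C : ℕ := ∑ I ∈ A, ((Finset.range M).filter fun j => ω ∈ H (x I) (I * M + j)).card with hC
    clear_value C
    have h2 : ENNReal.ofReal (γ ^ A.card * (1 + β) ^ C) < ENNReal.ofReal (Real.exp Y) := by
      refine lt_of_le_of_lt ?_ hω'
      rw [ENNReal.ofReal_mul (by positivity), ENNReal.ofReal_pow hγ0.le,
        ENNReal.ofReal_pow (by positivity), ENNReal.ofReal_add zero_le_one hβ0.le,
        ENNReal.ofReal_one]
      exact hlow
    have h3 := (ENNReal.ofReal_lt_ofReal_iff (Real.exp_pos Y)).1 h2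
    have h4 := Real.log_lt_log (by positivity) h3
    rw [Real.log_exp, Real.log_mul (by positivity) (by positivity), Real.log_pow, Real.log_pow, hγ,
      one_div, Real.log_inv] at h4
    have h5 : β / 2 ≤ Real.log (1 + β) := by
      have h6 := Real.one_sub_inv_le_log_of_pos (show 0 < 1 + β by positivity)
      have hβ1 : β ≤ 1 := by
        rw [hβ, div_le_one (by positivity)]
        linarith
      have h7 : β / 2 ≤ 1 - (1 + β)⁻¹ := by
        rw [show 1 - (1 + β)⁻¹ = β / (1 + β) by field_simp; ring]
        gcongr
        linarith
      linarith
    have h8 : (C : ℝ) * (β / 2) ≤ C * Real.log (1 + β) :=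
      mul_le_mul_of_nonneg_left h5 (Nat.cast_nonneg _)
    have h9 : (C : ℝ) * (β / 2) ≤ Y + A.card * Real.log (2 * X.card * n) := by linarith
    have h10 : 4 * q * (β / 2) = 1 := by
      rw [hβ]
      field_simp
      norm_num
    calc (C : ℝ) = 4 * q * (β / 2) * C := by rw [h10, one_mul]
      _ = 4 * q * (C * (β / 2)) := by ring
      _ ≤ _ := mul_le_mul_of_nonneg_left h9 (by positivity)

end ExponentialMoment

/-! ### Block counts and a single change of scale. -/

section BlockCounts

/-- The term `d = 0` is `1 / 0 = 0`. The others telescope against `2 * (√(d) - √(d - 1))`. -/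
lemma sum_inv_sqrt_le (M : ℕ) : ∑ d ∈ Finset.range (M + 1), 1 / √(d : ℝ) ≤ 2 * √M := by
  induction M with
  | zero => simp
  | succ M ih =>
    rw [Finset.sum_range_succ]
    have h1 : √(M : ℝ) ≤ √((M : ℝ) + 1) := Real.sqrt_le_sqrt (by linarith)
    have h2 : 0 < √((M : ℝ) + 1) := Real.sqrt_pos.2 (by positivity)
    have h3 : √((M : ℝ) + 1) ^ 2 = M + 1 := Real.sq_sqrt (by positivity)
    have h4 : √(M : ℝ) ^ 2 = M := Real.sq_sqrt (by positivity)
    have h5 : 1 / √((M : ℝ) + 1) ≤ 2 * (√((M : ℝ) + 1) - √M) := by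
      rw [div_le_iff₀ h2]
      nlinarith [sq_nonneg (√((M : ℝ) + 1) - √M)]
    push_cast
    linarith

/-- Sampled Hölder functions: bounded sequences with the Hölder modulus on the grid of mesh
`1 / N`. -/
def gridHolder (α : ℝ) (N : ℕ) : Set (ℕ → ℝ) :=
  {y | (∀ l, |y l| ≤ 1) ∧ ∀ k l : ℕ, |y k - y l| ≤ (|(k : ℝ) - l| / N) ^ α}

open Classical in
/-- The indices `l < N` at which `b` and `y` are `r`-close. -/
noncomputable def nearTimes (b y : ℕ → ℝ) (N : ℕ) (r : ℝ) : Finset ℕ :=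
  (Finset.range N).filter fun l => |b l - y l| ≤ r

/-- The number of blocks of length `L` met by `S`. -/
def blockCount (S : Finset ℕ) (L : ℕ) : ℕ := (S.image (· / L)).card

/-- The levels at which the values of a sampled Hölder function are discretized. -/
noncomputable def levelGrid (N : ℕ) : Finset ℝ :=
  (Finset.Icc (-(N : ℤ)) N).image fun m : ℤ => (m : ℝ) / N

lemma card_levelGrid_le (N : ℕ) : (levelGrid N).card ≤ 2 * N + 1 := by
  refine Finset.card_image_le.trans ?_
  rw [Int.card_Icc]
  omega

lemma levelGrid_nonempty (N : ℕ) : (levelGrid N).Nonempty :=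
  (Finset.nonempty_Icc.2 (by omega)).image _

lemma floor_mem_levelGrid {N : ℕ} (hN : 0 < N) {v : ℝ} (hv : |v| ≤ 1) :
    ((⌊N * v⌋ : ℤ) : ℝ) / N ∈ levelGrid N := by
  have hNp : (0 : ℝ) < N := by exact_mod_cast hN
  refine Finset.mem_image.2 ⟨_, Finset.mem_Icc.2 ⟨?_, ?_⟩, rfl⟩
  · rw [Int.le_floor]
    push_cast
    nlinarith [(abs_le.1 hv).1]
  · have : ((⌊N * v⌋ : ℤ) : ℝ) ≤ N := (Int.floor_le _).trans (by nlinarith [(abs_le.1 hv).2])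
    exact_mod_cast this

lemma abs_floor_div_sub_le {N : ℕ} (hN : 0 < N) (v : ℝ) :
    |v - ((⌊N * v⌋ : ℤ) : ℝ) / N| ≤ 1 / N := by
  have hNp : (0 : ℝ) < N := by exact_mod_cast hN
  have h1 := Int.floor_le (N * v)
  have h2 := Int.lt_floor_add_one (N * v)
  have e : v - ((⌊N * v⌋ : ℤ) : ℝ) / N = (N * v - ⌊N * v⌋) / N := by field_simp
  rw [e, abs_div, abs_of_nonneg (by linarith), abs_of_pos hNp]
  gcongr
  linarith

lemma nearTimes_image_subset (b y : ℕ → ℝ) {N L : ℕ} (r : ℝ) :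
    (nearTimes b y N r).image (· / L) ⊆ Finset.range (N / L + 1) := by
  intro I hI
  obtain ⟨l, hl, rfl⟩ := Finset.mem_image.1 hI
  have := Finset.mem_range.1 (Finset.mem_filter.1 hl).1
  exact Finset.mem_range.2 (Nat.lt_succ_of_le (Nat.div_le_div_right this.le))

variable {Ω : Type*} {mΩ : MeasurableSpace Ω} {P : Measure Ω} {B : ℝ≥0 → Ω → ℝ}

open Classical in
-- On each coarse block `y` is replaced by its rounded value at the left end. The three terms in
-- `hρ` are the closeness of `B` to `y`, the Hölder variation over a coarse block, and the rounding
-- error.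
lemma blockCount_le_sum_hits {α : ℝ} (hα : 0 ≤ α) {N L M : ℕ} (hN : 0 < N) (hL : 0 < L)
    (hM : 0 < M) {r ρ : ℝ}
    (hρ : r + ((M * L : ℕ) / N : ℝ) ^ α + 1 / N ≤ ρ) {y : ℕ → ℝ} (hy : y ∈ gridHolder α N) (ω : Ω) :
    blockCount (nearTimes (fun l => B ((l : ℝ≥0) / N) ω) y N r) L ≤
      ∑ I ∈ (nearTimes (fun l => B ((l : ℝ≥0) / N) ω) y N r).image (· / (M * L)),
        ((Finset.range M).filter fun j => ω ∈ blockHit B N L ρ (I * M + j)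
          (((⌊N * y (I * (M * L))⌋ : ℤ) : ℝ) / N)).card := by
  set S := nearTimes (fun l => B ((l : ℝ≥0) / N) ω) y N r with hS
  have hsub : S.image (· / L) ⊆ (S.image (· / (M * L))).biUnion fun I =>
      ((Finset.range M).filter fun j => ω ∈ blockHit B N L ρ (I * M + j)
          (((⌊N * y (I * (M * L))⌋ : ℤ) : ℝ) / N)).image (I * M + ·) := by
    intro k hk
    obtain ⟨l, hl, rfl⟩ := Finset.mem_image.1 hk
    have hlS := (Finset.mem_filter.1 hl).2
    refine Finset.mem_biUnion.2 ⟨l / (M * L), Finset.mem_image_of_mem _ hl, ?_⟩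
    have hdiv : l / (M * L) = l / L / M := by rw [mul_comm, Nat.div_div_eq_div_mul]
    have hdm : l / (M * L) * M + l / L % M = l / L := by
      rw [hdiv]; exact Nat.div_add_mod' _ _
    refine Finset.mem_image.2 ⟨l / L % M, Finset.mem_filter.2
      ⟨Finset.mem_range.2 (Nat.mod_lt _ hM), ?_⟩, hdm⟩
    rw [hdm]
    refine ⟨l, Finset.mem_Ico.2 ⟨Nat.div_mul_le_self l L, by
      rw [add_mul, one_mul]; exact Nat.lt_div_mul_add hL⟩, ?_⟩
    set I := l / (M * L) with hI
    have h1 : |y l - y (I * (M * L))| ≤ ((M * L : ℕ) / N : ℝ) ^ α := by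
      refine (hy.2 l _).trans (Real.rpow_le_rpow (by positivity) ?_ hα)
      gcongr
      have h2 : I * (M * L) ≤ l := Nat.div_mul_le_self l _
      have h3 : l ≤ I * (M * L) + M * L := by
        have := Nat.lt_div_mul_add (a := l) (b := M * L) (Nat.mul_pos hM hL)
        exact this.le
      have h2' : ((I * (M * L) : ℕ) : ℝ) ≤ l := by exact_mod_cast h2
      have h3' : (l : ℝ) ≤ ((I * (M * L) : ℕ) : ℝ) + (M * L : ℕ) := by exact_mod_cast h3
      rw [abs_of_nonneg (by linarith)]
      linarith
    have h4 := abs_floor_div_sub_le hN (y (I * (M * L)))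
    refine le_trans ?_ hρ
    calc |B ((l : ℝ≥0) / N) ω - ((⌊N * y (I * (M * L))⌋ : ℤ) : ℝ) / N|
        = |(B ((l : ℝ≥0) / N) ω - y l) + (y l - y (I * (M * L)))
          + (y (I * (M * L)) - ((⌊N * y (I * (M * L))⌋ : ℤ) : ℝ) / N)| := by
          congr 1; ring
      _ ≤ _ := (abs_add_three _ _ _)
      _ ≤ _ := by linarith
  refine (Finset.card_le_card hsub).trans (Finset.card_biUnion_le.trans ?_)
  exact Finset.sum_le_sum fun I _ => Finset.card_image_le

/-- One step of the multiscale argument: the number of blocks of length `L` that are hit is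
controlled by the number of blocks of length `M * L` that are hit. -/
lemma exists_event_blockCount_le [IsProbabilityMeasure P] (hB : IsPreBrownianReal B P)
    (hm : ∀ t, Measurable (B t)) {α : ℝ} (hα : 0 ≤ α) {N L M : ℕ} (hN : 0 < N) (hL : 0 < L)
    (hM : 0 < M) {r ρ a κ : ℝ} (hρ : r + ((M * L : ℕ) / N : ℝ) ^ α + 1 / N ≤ ρ) (hρ0 : 0 ≤ ρ)
    (ha : 0 ≤ a) (hκ : 1 ≤ κ) (hκρ : (ρ + a) / √((L : ℝ) / N) ≤ κ)
    (hκa : √M * (L * (2 * Real.exp (-(a ^ 2 / (2 * (L / N)))))) ≤ κ) (Y : ℝ) :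
    ∃ D : Set Ω, P D ≤ ENNReal.ofReal (Real.exp (1 - Y)) ∧ ∀ ω ∉ D, ∀ y ∈ gridHolder α N,
      (blockCount (nearTimes (fun l => B ((l : ℝ≥0) / N) ω) y N r) L : ℝ) ≤
        16 * κ * √M * (Y +
          blockCount (nearTimes (fun l => B ((l : ℝ≥0) / N) ω) y N r) (M * L) *
            Real.log (2 * (2 * N + 1) * (N + 1))) := by
  classical
  have hNp : (0 : ℝ) < N := by exact_mod_cast hN
  have hLp : (0 : ℝ) < L := by exact_mod_cast hL
  have hMp : (1 : ℝ) ≤ M := by exact_mod_cast hM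
  set τ : ℝ := L * (2 * Real.exp (-(a ^ 2 / (2 * (L / N))))) with hτ
  -- The current block gets the trivial bound 1. At distance `d` the standard deviation is `√d * √(L
  -- / N)`, whence `κ / √d`; `τ` accounts for large increments inside a block.
  set p : ℕ → ℝ≥0∞ := fun d => ENNReal.ofReal (if d = 0 then 1 else κ * (1 / √(d : ℝ)) + τ) with hp
  have hpc : ∀ (x : ℝ) (i k : ℕ), i ≤ k → CondBound (pastSigma B ((i * L : ℕ) / N)) P
      ((blockHit B N L ρ k x).indicator 1) (p (k - i)) := by
    intro x i k hik
    rcases hik.eq_or_lt with rfl | hlt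
    · simp only [hp, Nat.sub_self, if_true, ENNReal.ofReal_one]
      exact (CondBound.const (pastSigma_le hm _) 1).mono
        (fun ω => Set.indicator_le_self _ _ _) le_rfl
    · refine (condBound_blockHit hB hm hN hL hlt hρ0 ha x).mono (fun _ => le_rfl) ?_
      refine ENNReal.ofReal_le_ofReal ?_
      have hd : k - i ≠ 0 := by omega
      have hdp : (0 : ℝ) < ((k - i : ℕ) : ℝ) := by positivity
      rw [if_neg hd]
      gcongr
      rw [mul_div_assoc, Real.sqrt_mul (Nat.cast_nonneg _), mul_comm (√((k - i : ℕ) : ℝ)), ← div_div,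
        mul_one_div]
      gcongr
  -- The four units of `κ * √M` are one for `d = 0`, two for the sum of `1 / √d`, and one for `M * τ
  -- = √M * (√M * τ)`.
  have hq : ∑ d ∈ Finset.range M, p d ≤ ENNReal.ofReal (4 * κ * √M) := by
    rw [hp, ← ENNReal.ofReal_sum_of_nonneg (fun d _ => by split_ifs <;> positivity)]
    refine ENNReal.ofReal_le_ofReal ?_
    have hsM : 1 ≤ √(M : ℝ) := Real.one_le_sqrt.2 hMp
    obtain ⟨K, rfl⟩ : ∃ K, M = K + 1 := ⟨M - 1, by omega⟩
    calc ∑ d ∈ Finset.range (K + 1), (if d = 0 then (1 : ℝ) else κ * (1 / √(d : ℝ)) + τ)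
        ≤ ∑ d ∈ Finset.range (K + 1), ((if d = 0 then (1 : ℝ) else 0) + κ * (1 / √(d : ℝ)) + τ) := by
          refine Finset.sum_le_sum fun d _ => ?_
          split_ifs with h
          · have : 0 ≤ κ * (1 / √(d : ℝ)) + τ := by positivity
            linarith
          · linarith
      _ = 1 + κ * ∑ d ∈ Finset.range (K + 1), 1 / √(d : ℝ) + ((K + 1 : ℕ) : ℝ) * τ := by
          rw [Finset.sum_add_distrib, Finset.sum_add_distrib, ← Finset.mul_sum]
          simp
      _ ≤ 1 + κ * (2 * √((K + 1 : ℕ) : ℝ)) + √((K + 1 : ℕ) : ℝ) * κ := by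
          have h1 : ∑ d ∈ Finset.range (K + 1), 1 / √(d : ℝ) ≤ 2 * √((K + 1 : ℕ) : ℝ) :=
            (sum_inv_sqrt_le K).trans (by gcongr; simp)
          have h2 : ((K + 1 : ℕ) : ℝ) * τ ≤ √((K + 1 : ℕ) : ℝ) * κ := by
            have h3 := mul_le_mul_of_nonneg_left hκa (Real.sqrt_nonneg ((K + 1 : ℕ) : ℝ))
            rwa [← mul_assoc, Real.mul_self_sqrt (Nat.cast_nonneg _)] at h3
          have h4 := mul_le_mul_of_nonneg_left h1 (zero_le_one.trans hκ)
          linarith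
      _ ≤ _ := by nlinarith
  obtain ⟨D, hD, hDω⟩ := exists_event_total_hits_le (P := P)
    (F := fun k => pastSigma B ((k * L : ℕ) / N)) (H := fun (x : ℝ) k => blockHit B N L ρ k x) (p := p)
    (fun k => pastSigma_le hm _)
    (fun i j hij => pastSigma_mono (by gcongr))
    (fun x k => measurableSet_blockHit_pastSigma N L ρ k x) hpc (M := M)
    (q := 4 * κ * √M) (by nlinarith [Real.one_le_sqrt.2 hMp]) hq (levelGrid_nonempty N)
    (n := N / (M * L) + 1) (Nat.succ_pos _) Y
  refine ⟨D, hD, fun ω hω y hy => ?_⟩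
  have h1 := blockCount_le_sum_hits (B := B) hα hN hL hM hρ hy ω
  have h2 := hDω ω hω _ (nearTimes_image_subset (fun l => B ((l : ℝ≥0) / N) ω) y (L := M * L) r)
    (fun I => ((⌊N * y (I * (M * L))⌋ : ℤ) : ℝ) / N) (fun I _ => floor_mem_levelGrid hN (hy.1 _))
  refine (Nat.cast_le.2 h1).trans (h2.trans ?_)
  rw [show 4 * (4 * κ * √(M : ℝ)) = 16 * κ * √M by ring]
  refine mul_le_mul_of_nonneg_left ?_ (by positivity)
  unfold blockCount
  gcongr
  · have : 0 < (levelGrid N).card := (levelGrid_nonempty N).card_pos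
    positivity
  · exact_mod_cast card_levelGrid_le N
  · exact_mod_cast Nat.succ_le_succ (Nat.div_le_self N (M * L))

end BlockCounts

/-! ### Iteration over time scales. -/

section Multiscale

/-- The length of the dyadic blocks at scale exponent `a`: the largest power of two not exceeding
`N ^ (1 - a)`. -/
noncomputable def blockLen (a : ℝ) (N : ℕ) : ℕ := 2 ^ Nat.log 2 ⌊(N : ℝ) ^ (1 - a)⌋₊

lemma blockLen_pos (a : ℝ) (N : ℕ) : 0 < blockLen a N := by unfold blockLen; positivity

lemma blockLen_le {a : ℝ} (ha : a ≤ 1) {N : ℕ} (hN : 0 < N) :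
    (blockLen a N : ℝ) ≤ (N : ℝ) ^ (1 - a) := by
  have h1 : (1 : ℝ) ≤ (N : ℝ) ^ (1 - a) :=
    Real.one_le_rpow (by exact_mod_cast hN) (by linarith)
  have h2 : ⌊(N : ℝ) ^ (1 - a)⌋₊ ≠ 0 := (Nat.floor_pos.2 h1).ne'
  calc (blockLen a N : ℝ) ≤ (⌊(N : ℝ) ^ (1 - a)⌋₊ : ℝ) := by
        exact_mod_cast Nat.pow_log_le_self 2 h2
    _ ≤ _ := Nat.floor_le (by linarith)

lemma lt_two_mul_blockLen (a : ℝ) (N : ℕ) : (N : ℝ) ^ (1 - a) < 2 * blockLen a N := by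
  have h1 : ⌊(N : ℝ) ^ (1 - a)⌋₊ + 1 ≤ 2 * blockLen a N := by
    have := Nat.lt_pow_succ_log_self (b := 2) (by norm_num) ⌊(N : ℝ) ^ (1 - a)⌋₊
    rw [pow_succ] at this
    unfold blockLen
    omega
  calc (N : ℝ) ^ (1 - a) < (⌊(N : ℝ) ^ (1 - a)⌋₊ : ℝ) + 1 := Nat.lt_floor_add_one _
    _ ≤ _ := by exact_mod_cast h1

/-- This is why block lengths are rounded to powers of two: fine blocks exactly subdivide coarse
ones. -/
lemma exists_blockLen_eq_mul {a a' : ℝ} (haa : a ≤ a') {N : ℕ} (hN : 0 < N) :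
    ∃ M, 0 < M ∧ blockLen a N = M * blockLen a' N := by
  have hlog : Nat.log 2 ⌊(N : ℝ) ^ (1 - a')⌋₊ ≤ Nat.log 2 ⌊(N : ℝ) ^ (1 - a)⌋₊ := by
    refine Nat.log_mono_right (Nat.floor_mono ?_)
    exact Real.rpow_le_rpow_of_exponent_le (by exact_mod_cast hN) (by linarith)
  refine ⟨2 ^ (Nat.log 2 ⌊(N : ℝ) ^ (1 - a)⌋₊ - Nat.log 2 ⌊(N : ℝ) ^ (1 - a')⌋₊), by positivity, ?_⟩
  unfold blockLen
  rw [← pow_add, Nat.sub_add_cancel hlog]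

lemma exists_exp_neg_rpow_le {η : ℝ} (hη : 0 < η) :
    ∃ K : ℝ, 0 < K ∧ ∀ x : ℝ, 1 ≤ x → Real.exp (-(x ^ η / 2)) ≤ K * x ^ (-2 : ℝ) := by
  obtain ⟨k, hk⟩ := exists_nat_ge (2 / η)
  refine ⟨k.factorial * 2 ^ k, by positivity, fun x hx => ?_⟩
  have hx0 : 0 < x := by linarith
  have h1 := Real.pow_div_factorial_le_exp (x ^ η / 2) (by positivity) k
  have h2 : x ^ (2 : ℝ) ≤ (x ^ η) ^ k := by
    rw [← Real.rpow_natCast, ← Real.rpow_mul hx0.le]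
    refine Real.rpow_le_rpow_of_exponent_le hx ?_
    rwa [div_le_iff₀ hη, mul_comm] at hk
  rw [Real.exp_neg, Real.rpow_neg hx0.le, inv_le_comm₀ (Real.exp_pos _) (by positivity)]
  refine le_trans ?_ h1
  rw [div_pow, mul_inv, inv_inv, div_div, mul_comm (2 ^ k : ℝ), inv_mul_eq_div]
  gcongr

lemma exists_log_grid_le {η : ℝ} (hη : 0 < η) :
    ∃ K : ℝ, 0 < K ∧ ∀ N : ℕ, 0 < N →
      Real.log (2 * (2 * N + 1) * (N + 1)) ≤ K * (N : ℝ) ^ η := by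
  refine ⟨12 ^ (η / 2) / (η / 2), by positivity, fun N hN => ?_⟩
  have hN1 : (1 : ℝ) ≤ N := by exact_mod_cast hN
  calc Real.log (2 * (2 * N + 1) * (N + 1)) ≤ Real.log (12 * (N : ℝ) ^ (2 : ℝ)) := by
        refine Real.log_le_log (by positivity) ?_
        rw [Real.rpow_two]
        nlinarith
    _ ≤ (12 * (N : ℝ) ^ (2 : ℝ)) ^ (η / 2) / (η / 2) := Real.log_le_rpow_div (by positivity) (by positivity)
    _ = _ := by
        rw [Real.mul_rpow (by norm_num) (by positivity), ← Real.rpow_mul (by positivity),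
          show 2 * (η / 2) = η by ring]
        ring

/-- Up to an event of small probability, the number of blocks at scale exponent `a` where the
process is close to a sampled Hölder function is at most of order `N ^ (a / 2 + ε + δ)`. -/
def HitBound.{u} (α ε C a : ℝ) : Prop :=
  ∀ δ : ℝ, 0 < δ → ∃ c₁ c₃ : ℝ, 0 < c₁ ∧ 0 < c₃ ∧
    ∀ (Ω : Type u) [MeasurableSpace Ω] (P : Measure Ω) [IsProbabilityMeasure P]
      (B : ℝ≥0 → Ω → ℝ), IsPreBrownianReal B P → (∀ t, Measurable (B t)) →
      ∀ N : ℕ, 0 < N → ∃ D : Set Ω,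
        P D ≤ ENNReal.ofReal (c₁ * Real.exp (-(N : ℝ) ^ (ε / 2))) ∧
        ∀ ω ∉ D, ∀ y ∈ gridHolder α N,
          (blockCount (nearTimes (fun l => B ((l : ℝ≥0) / N) ω) y N
            (C * (N : ℝ) ^ (-(1 / 2) + ε / 2))) (blockLen a N) : ℝ)
            ≤ c₃ * (N : ℝ) ^ (a / 2 + ε + δ)

/-- There are at most `3 * N ^ ε` blocks in all, so no exceptional event is needed. -/
lemma HitBound.base.{u} (α C : ℝ) {ε : ℝ} (hε : 0 < ε) : HitBound.{u} α ε C ε := by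
  intro δ hδ
  refine ⟨1, 3, one_pos, by norm_num, fun Ω _ P _ B hB hm N hN => ⟨∅, by simp, fun ω _ y hy => ?_⟩⟩
  have hN1 : (1 : ℝ) ≤ N := by exact_mod_cast hN
  have hN0 : (0 : ℝ) < N := by linarith
  have hL := blockLen_pos ε N
  have hLp : (0 : ℝ) < blockLen ε N := by exact_mod_cast hL
  have h1 : (blockCount (nearTimes (fun l => B ((l : ℝ≥0) / N) ω) y N
      (C * (N : ℝ) ^ (-(1 / 2) + ε / 2))) (blockLen ε N) : ℝ) ≤ (N / blockLen ε N : ℕ) + 1 := by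
    have := Finset.card_le_card (nearTimes_image_subset (fun l => B ((l : ℝ≥0) / N) ω) y
      (N := N) (L := blockLen ε N) (C * (N : ℝ) ^ (-(1 / 2) + ε / 2)))
    rw [Finset.card_range] at this
    exact_mod_cast this
  have h2 : ((N / blockLen ε N : ℕ) : ℝ) ≤ 2 * (N : ℝ) ^ ε := by
    refine Nat.cast_div_le.trans ?_
    rw [div_le_iff₀ hLp]
    have h3 := lt_two_mul_blockLen ε N
    calc (N : ℝ) = (N : ℝ) ^ ε * (N : ℝ) ^ (1 - ε) := by
          rw [← Real.rpow_add hN0]; simp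
      _ ≤ (N : ℝ) ^ ε * (2 * blockLen ε N) := by gcongr
      _ = _ := by ring
  have h4 : (1 : ℝ) ≤ (N : ℝ) ^ ε := Real.one_le_rpow hN1 hε.le
  have h5 : (N : ℝ) ^ ε ≤ (N : ℝ) ^ (ε / 2 + ε + δ) :=
    Real.rpow_le_rpow_of_exponent_le hN1 (by linarith)
  linarith

set_option maxHeartbeats 400000 in
-- `haα` keeps the Hölder variation over a coarse block, and `ha'` the closeness radius, below the
-- Brownian scale `N ^ (-a' / 2)` of a fine block. The factor `√M` then raises the exponent `a / 2`
-- to `a' / 2`.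
lemma HitBound.step.{u} {α ε C a a' : ℝ} (hα : 0 ≤ α) (hε : 0 < ε) (hC : 0 ≤ C) (ha : 0 ≤ a)
    (haa : a ≤ a') (ha' : a' ≤ 1 - ε) (haα : a' ≤ 2 * α * a) (h : HitBound.{u} α ε C a) :
    HitBound.{u} α ε C a' := by
  intro δ hδ
  -- `N ^ η` is lost twice, in `κ` and in the logarithm; with the `δ / 2` of the coarser scale this
  -- makes `δ`.
  set η := δ / 4 with hη
  have hη0 : 0 < η := by positivity
  obtain ⟨c₁, c₃, hc₁, hc₃, hQ⟩ := h (δ / 2) (by positivity)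
  obtain ⟨K₁, hK₁, hexp⟩ := exists_exp_neg_rpow_le (η := 2 * η) (by positivity)
  obtain ⟨K₂, hK₂, hlog⟩ := exists_log_grid_le hη0
  set K : ℝ := 2 * (C + 3) + 2 * K₁ + 1 with hK
  refine ⟨c₁ + Real.exp 1, 16 * K * 2 * (1 + c₃ * K₂), by positivity, by positivity, ?_⟩
  intro Ω _ P _ B hB hm N hN
  have hN1 : (1 : ℝ) ≤ N := by exact_mod_cast hN
  have hN0 : (0 : ℝ) < N := by linarith
  obtain ⟨D₁, hD₁, hD₁ω⟩ := hQ Ω P B hB hm N hN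
  obtain ⟨M, hM, hLM⟩ := exists_blockLen_eq_mul haa hN
  set L := blockLen a' N with hL
  have hLpos : 0 < L := blockLen_pos a' N
  have hLp : (0 : ℝ) < L := by exact_mod_cast hLpos
  have hLle : (L : ℝ) ≤ (N : ℝ) ^ (1 - a') := blockLen_le (by linarith) hN
  have hLge : (N : ℝ) ^ (1 - a') < 2 * L := lt_two_mul_blockLen a' N
  have hLa : ((M * L : ℕ) : ℝ) ≤ (N : ℝ) ^ (1 - a) := by
    rw [← hLM]; exact blockLen_le (by linarith) hN
  have hdiv : ∀ b : ℝ, (N : ℝ) ^ (1 - b) = (N : ℝ) ^ (-b) * N := fun b => by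
    rw [show 1 - b = -b + 1 by ring, Real.rpow_add hN0, Real.rpow_one]
  have hLN : (L : ℝ) / N ≤ (N : ℝ) ^ (-a') := by
    rw [div_le_iff₀ hN0, ← hdiv]; exact hLle
  have hLN' : (N : ℝ) ^ (-a') / 2 ≤ (L : ℝ) / N := by
    rw [div_le_div_iff₀ two_pos hN0, ← hdiv]; linarith
  have hMN : (M : ℝ) ≤ 2 * (N : ℝ) ^ (a' - a) := by
    have h1 : (M : ℝ) * (N : ℝ) ^ (1 - a') ≤ 2 * (N : ℝ) ^ (a' - a) * (N : ℝ) ^ (1 - a') := by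
      calc (M : ℝ) * (N : ℝ) ^ (1 - a') ≤ M * (2 * L) := by gcongr
        _ = 2 * ((M * L : ℕ) : ℝ) := by push_cast; ring
        _ ≤ 2 * (N : ℝ) ^ (1 - a) := by gcongr
        _ = _ := by
          rw [mul_assoc, ← Real.rpow_add hN0]
          congr 2; ring
    exact le_of_mul_le_mul_right h1 (by positivity)
  have hsq : ∀ b : ℝ, √((N : ℝ) ^ b) = (N : ℝ) ^ (b / 2) := fun b => by
    rw [Real.sqrt_eq_rpow, ← Real.rpow_mul hN0.le]
    congr 1; ring
  have hsM : √(M : ℝ) ≤ 2 * (N : ℝ) ^ ((a' - a) / 2) := by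
    calc √(M : ℝ) ≤ √(2 ^ 2 * (N : ℝ) ^ (a' - a)) := by
          refine Real.sqrt_le_sqrt (hMN.trans ?_)
          gcongr
          norm_num
      _ = _ := by rw [Real.sqrt_mul (by norm_num), Real.sqrt_sq (by norm_num), hsq]
  have hsL : (N : ℝ) ^ (-a' / 2) ≤ 2 * √((L : ℝ) / N) := by
    calc (N : ℝ) ^ (-a' / 2) = √((N : ℝ) ^ (-a')) := (hsq _).symm
      _ ≤ √(2 ^ 2 * ((L : ℝ) / N)) := by
        refine Real.sqrt_le_sqrt ?_
        have : 0 < (L : ℝ) / N := by positivity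
        linarith
      _ = _ := by rw [Real.sqrt_mul (by norm_num), Real.sqrt_sq (by norm_num)]
  set ρ : ℝ := (C + 2) * (N : ℝ) ^ (-a' / 2) with hρ
  -- The increment threshold exceeds the standard deviation over a fine block by `N ^ η`, so its
  -- tail beats every power of `N`.
  set d : ℝ := (N : ℝ) ^ (η - a' / 2) with hd
  have hη1 : (1 : ℝ) ≤ (N : ℝ) ^ η := Real.one_le_rpow hN1 hη0.le
  have hdη : d = (N : ℝ) ^ η * (N : ℝ) ^ (-a' / 2) := by
    rw [hd, ← Real.rpow_add hN0]; congr 1; ring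
  have hρle : C * (N : ℝ) ^ (-(1 / 2) + ε / 2) + ((M * L : ℕ) / N : ℝ) ^ α + 1 / N ≤ ρ := by
    have h1 : (N : ℝ) ^ (-(1 / 2) + ε / 2) ≤ (N : ℝ) ^ (-a' / 2) :=
      Real.rpow_le_rpow_of_exponent_le hN1 (by linarith)
    have h2 : ((M * L : ℕ) / N : ℝ) ^ α ≤ (N : ℝ) ^ (-a' / 2) := by
      calc ((M * L : ℕ) / N : ℝ) ^ α ≤ ((N : ℝ) ^ (-a)) ^ α := by
            refine Real.rpow_le_rpow (by positivity) ?_ hα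
            rw [div_le_iff₀ hN0, ← hdiv]; exact hLa
        _ = (N : ℝ) ^ (-a * α) := by rw [← Real.rpow_mul hN0.le]
        _ ≤ _ := Real.rpow_le_rpow_of_exponent_le hN1 (by linarith)
    have h3 : 1 / (N : ℝ) ≤ (N : ℝ) ^ (-a' / 2) := by
      rw [one_div, ← Real.rpow_neg_one]
      exact Real.rpow_le_rpow_of_exponent_le hN1 (by linarith)
    have h4 := mul_le_mul_of_nonneg_left h1 hC
    rw [hρ]
    linarith
  have hκρ : (ρ + d) / √((L : ℝ) / N) ≤ K * (N : ℝ) ^ η := by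
    rw [div_le_iff₀ (Real.sqrt_pos.2 (by positivity))]
    have h1 : ρ ≤ (C + 2) * ((N : ℝ) ^ η * (N : ℝ) ^ (-a' / 2)) := by
      rw [hρ]
      gcongr
      exact le_mul_of_one_le_left (by positivity) hη1
    calc ρ + d ≤ (C + 3) * ((N : ℝ) ^ η * (N : ℝ) ^ (-a' / 2)) := by
          rw [hdη] at *; linarith
      _ ≤ (C + 3) * ((N : ℝ) ^ η * (2 * √((L : ℝ) / N))) := by gcongr
      _ = 2 * (C + 3) * (N : ℝ) ^ η * √((L : ℝ) / N) := by ring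
      _ ≤ K * (N : ℝ) ^ η * √((L : ℝ) / N) := by
        gcongr
        rw [hK]; linarith
  have hκ1 : 1 ≤ K * (N : ℝ) ^ η := by
    have : 1 ≤ K := by rw [hK]; linarith
    exact one_le_mul_of_one_le_of_one_le this hη1
  have hκd : √(M : ℝ) * (L * (2 * Real.exp (-(d ^ 2 / (2 * (L / N)))))) ≤ K * (N : ℝ) ^ η := by
    have hd2 : d ^ 2 = (N : ℝ) ^ (2 * η) * (N : ℝ) ^ (-a') := by
      rw [hd, ← Real.rpow_natCast, ← Real.rpow_mul hN0.le, ← Real.rpow_add hN0]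
      congr 1; push_cast; ring
    have h1 : (N : ℝ) ^ (2 * η) / 2 ≤ d ^ 2 / (2 * (L / N)) := by
      rw [div_le_div_iff₀ two_pos (by positivity), hd2]
      have := mul_le_mul_of_nonneg_left hLN (show 0 ≤ (N : ℝ) ^ (2 * η) by positivity)
      linarith
    have hML : (M : ℝ) * L ≤ N := by
      have : ((M * L : ℕ) : ℝ) ≤ (N : ℝ) ^ (1 : ℝ) :=
        hLa.trans (Real.rpow_le_rpow_of_exponent_le hN1 (by linarith))
      rw [Real.rpow_one] at this
      exact_mod_cast this
    have hM1 : (1 : ℝ) ≤ M := by exact_mod_cast hM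
    have hsM' : √(M : ℝ) ≤ M := by
      rw [Real.sqrt_le_left (by linarith)]
      nlinarith
    have h2 : Real.exp (-(d ^ 2 / (2 * (L / N)))) ≤ K₁ * (N : ℝ) ^ (-2 : ℝ) :=
      (Real.exp_le_exp.2 (by linarith)).trans (hexp N hN1)
    have h3 : (N : ℝ) * (N : ℝ) ^ (-2 : ℝ) ≤ 1 := by
      nth_rewrite 1 [← Real.rpow_one (N : ℝ)]
      rw [← Real.rpow_add hN0]
      exact Real.rpow_le_one_of_one_le_of_nonpos hN1 (by norm_num)
    calc √(M : ℝ) * (L * (2 * Real.exp (-(d ^ 2 / (2 * (L / N))))))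
        ≤ M * (L * (2 * (K₁ * (N : ℝ) ^ (-2 : ℝ)))) := by gcongr
      _ = (M * L) * (2 * (K₁ * (N : ℝ) ^ (-2 : ℝ))) := by ring
      _ ≤ N * (2 * (K₁ * (N : ℝ) ^ (-2 : ℝ))) := by gcongr
      _ = 2 * K₁ * (N * (N : ℝ) ^ (-2 : ℝ)) := by ring
      _ ≤ 2 * K₁ * 1 := by gcongr
      _ ≤ K * 1 := by rw [hK]; linarith
      _ ≤ K * (N : ℝ) ^ η := by gcongr
  obtain ⟨D₂, hD₂, hD₂ω⟩ := exists_event_blockCount_le hB hm hα hN hLpos hM hρle (by positivity)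
    (by positivity) hκ1 hκρ hκd ((N : ℝ) ^ (ε / 2))
  refine ⟨D₁ ∪ D₂, ?_, fun ω hω y hy => ?_⟩
  · refine (measure_union_le _ _).trans ((add_le_add hD₁ hD₂).trans ?_)
    rw [← ENNReal.ofReal_add (by positivity) (by positivity)]
    refine ENNReal.ofReal_le_ofReal (le_of_eq ?_)
    rw [add_mul, ← Real.exp_add]
    rfl
  · have h1 := hD₁ω ω (fun h => hω (Or.inl h)) y hy
    have h2 := hD₂ω ω (fun h => hω (Or.inr h)) y hy
    rw [hLM] at h1
    refine h2.trans ?_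
    -- The additive cost `Y = N ^ (ε / 2)` of the exceptional event is absorbed by the `ε` in the
    -- exponent.
    have hE : (N : ℝ) ^ (ε / 2) ≤ (N : ℝ) ^ (a / 2 + ε + δ / 2) * (N : ℝ) ^ η := by
      rw [← Real.rpow_add hN0]
      exact Real.rpow_le_rpow_of_exponent_le hN1 (by linarith)
    calc _ ≤ 16 * (K * (N : ℝ) ^ η) * (2 * (N : ℝ) ^ ((a' - a) / 2)) *
          ((N : ℝ) ^ (a / 2 + ε + δ / 2) * (N : ℝ) ^ η
            + c₃ * (N : ℝ) ^ (a / 2 + ε + δ / 2) * (K₂ * (N : ℝ) ^ η)) := by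
          have hl0 : 0 ≤ Real.log (2 * (2 * (N : ℝ) + 1) * (N + 1)) :=
            Real.log_nonneg (one_le_mul_of_one_le_of_one_le (by linarith only [hN1])
              (by linarith only [hN1]))
          have h3 := mul_le_mul h1 (hlog N hN) hl0
            (mul_nonneg hc₃.le (Real.rpow_nonneg hN0.le _))
          have h4 := mul_le_mul_of_nonneg_left hsM
            (mul_nonneg (by norm_num : (0 : ℝ) ≤ 16) (zero_le_one.trans hκ1))
          have h5 : 0 ≤ 16 * (K * (N : ℝ) ^ η) * (2 * (N : ℝ) ^ ((a' - a) / 2)) :=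
            (mul_nonneg (mul_nonneg (by norm_num) (zero_le_one.trans hκ1))
              (Real.sqrt_nonneg (M : ℝ))).trans h4
          exact mul_le_mul h4 (add_le_add hE h3)
            (add_nonneg (Real.rpow_nonneg hN0.le _) (mul_nonneg (Nat.cast_nonneg _) hl0)) h5
      _ = 16 * K * 2 * (1 + c₃ * K₂) * ((N : ℝ) ^ η * (N : ℝ) ^ ((a' - a) / 2) *
          (N : ℝ) ^ (a / 2 + ε + δ / 2) * (N : ℝ) ^ η) := by ring
      _ = _ := by
        rw [← Real.rpow_add hN0, ← Real.rpow_add hN0, ← Real.rpow_add hN0]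
        congr 2
        rw [hη]; ring

/-- Each step multiplies the scale exponent by `2 * α > 1`, capped at `1 - ε`. The number of steps
depends only on `α` and `ε`, hence so do the constants. -/
lemma HitBound.final.{u} {α ε C : ℝ} (hα : 1 / 2 < α) (hε : 0 < ε) (hε' : ε ≤ 1 / 2) (hC : 0 ≤ C) :
    HitBound.{u} α ε C (1 - ε) := by
  have key : ∀ k : ℕ, HitBound.{u} α ε C (min ((2 * α) ^ k * ε) (1 - ε)) := by
    intro k
    induction k with
    | zero =>
      rw [pow_zero, one_mul, min_eq_left (by linarith)]
      exact HitBound.base α C hε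
    | succ k ih =>
      have h1 : (2 * α) ^ k * ε ≤ (2 * α) ^ (k + 1) * ε := by
        gcongr
        · linarith
        · omega
      have h0 : 0 ≤ min ((2 * α) ^ k * ε) (1 - ε) :=
        le_min (by positivity) (by linarith)
      refine HitBound.step (by linarith) hε hC h0 (min_le_min_right _ h1) (min_le_right _ _) ?_ ih
      rcases le_total ((2 * α) ^ k * ε) (1 - ε) with h | h
      · rw [min_eq_left h, pow_succ']
        exact (min_le_left _ _).trans (by linarith)
      · rw [min_eq_right h]
        refine (min_le_right _ _).trans ?_
        nlinarith
  obtain ⟨k, hk⟩ := pow_unbounded_of_one_lt (1 / ε) (show 1 < 2 * α by linarith)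
  have := key k
  rw [div_lt_iff₀ hε] at hk
  rwa [min_eq_right (by linarith)] at this

end Multiscale

/-! ### Oscillation of Brownian motion between grid times. -/

section Oscillation

open Filter Topology

/-- Dyadic chaining: bounds on dyadic increments control the oscillation of a continuous path. -/
lemma abs_sub_le_of_dyadic {w : ℝ≥0 → ℝ} (hw : Continuous w) {A : ℝ} (hA : 0 ≤ A) (s h : ℝ≥0)
    (hdy : ∀ j i : ℕ, i < 2 ^ j →
      |w (s + ((i + 1 : ℕ) : ℝ≥0) / 2 ^ j * h) - w (s + (i : ℝ≥0) / 2 ^ j * h)| ≤ A * (3 / 4) ^ j)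
    {τ : ℝ≥0} (hτ : τ ≤ 1) : |w (s + τ * h) - w s| ≤ 4 * A := by
  -- Dyadic approximation of `τ` from below: each refinement moves by zero or one dyadic interval,
  -- and the increments sum to at most `4 * A`.
  set k : ℕ → ℕ := fun j => ⌊2 ^ j * τ⌋₊ with hk
  set x : ℕ → ℝ := fun j => w (s + (k j : ℝ≥0) / 2 ^ j * h) with hx
  have hstep : ∀ j, |x (j + 1) - x j| ≤ A * (3 / 4) ^ (j + 1) := by
    intro j
    have h1 : (k j : ℝ≥0) ≤ 2 ^ j * τ := Nat.floor_le zero_le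
    have h2 : 2 ^ j * τ < k j + 1 := Nat.lt_floor_add_one _
    have h3 : 2 * k j ≤ k (j + 1) := by
      refine Nat.le_floor ?_
      push_cast
      rw [pow_succ', mul_assoc]
      gcongr
    have h4 : k (j + 1) < 2 * k j + 2 := by
      rw [hk, Nat.floor_lt zero_le]
      push_cast
      rw [pow_succ', mul_assoc, show (2 : ℝ≥0) * k j + 2 = 2 * (k j + 1) by ring]
      gcongr
    have h6 : ((2 * k j : ℕ) : ℝ≥0) / 2 ^ (j + 1) = (k j : ℝ≥0) / 2 ^ j := by
      push_cast
      rw [pow_succ']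
      field_simp
    rcases (by omega : k (j + 1) = 2 * k j ∨ k (j + 1) = 2 * k j + 1) with h5 | h5
    · rw [hx]
      simp only
      rw [h5, h6, sub_self, abs_zero]
      positivity
    · have h7 : k (j + 1) ≤ 2 ^ (j + 1) := by
        refine Nat.floor_le_of_le ?_
        push_cast
        exact mul_le_of_le_one_right zero_le hτ
      have := hdy (j + 1) (2 * k j) (by omega)
      rw [h6, ← h5] at this
      exact this
  have hzero : |x 0 - w s| ≤ A := by
    have h7 : k 0 ≤ 1 := by
      refine Nat.floor_le_of_le ?_
      simpa using hτ
    rcases (by omega : k 0 = 0 ∨ k 0 = 1) with h | h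
    · rw [hx]
      simp only
      rw [h]
      simpa using hA
    · have := hdy 0 0 (by norm_num)
      rw [hx]
      simp only
      rw [h]
      simpa using this
  have hsum : ∀ j, |x j - w s| ≤ A * (4 - 3 * (3 / 4) ^ j) := by
    intro j
    induction j with
    | zero => norm_num; exact hzero
    | succ j ih =>
      have h1 := abs_sub_le (x (j + 1)) (x j) (w s)
      have h2 := hstep j
      calc |x (j + 1) - w s| ≤ A * (3 / 4) ^ (j + 1) + A * (4 - 3 * (3 / 4) ^ j) := by linarith
        _ = _ := by rw [pow_succ]; ring
  have hlim : Tendsto x atTop (𝓝 (w (s + τ * h))) := by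
    refine (hw.tendsto _).comp ?_
    refine Tendsto.const_add s (Tendsto.mul_const h ?_)
    have h2 : Tendsto (fun j : ℕ => (2 : ℝ≥0) ^ j) atTop atTop :=
      tendsto_pow_atTop_atTop_of_one_lt (by norm_num)
    have h3 := (tendsto_nat_floor_mul_div_atTop (R := ℝ) (a := τ) τ.2).comp
      (tendsto_pow_atTop_atTop_of_one_lt (r := (2 : ℝ)) (by norm_num))
    rw [← NNReal.tendsto_coe]
    refine h3.congr fun j => ?_
    have h4 : ⌊(τ : ℝ) * 2 ^ j⌋₊ = k j := by
      rw [hk]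
      simp only
      rw [← show ⌊((2 ^ j * τ : ℝ≥0) : ℝ)⌋₊ = ⌊2 ^ j * τ⌋₊ from Nonneg.nat_floor_coe _]
      push_cast
      rw [mul_comm]
    simp only [Function.comp_apply, h4]
    push_cast
    rfl
  refine le_of_tendsto ((hlim.sub_const (w s)).abs) (Eventually.of_forall fun j => ?_)
  refine (hsum j).trans ?_
  have : (0 : ℝ) ≤ (3 / 4) ^ j := by positivity
  nlinarith

/-- The thresholds `A * (3 / 4) ^ j` decay more slowly than the standard deviations `2 ^ (-j / 2) /
√N`, so the tail exponent grows like `(9 / 8) ^ j`. Already its linear lower bound pays for the `2 ^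
j` intervals of level `j`, because `2 / e ≤ 3 / 4`. -/
lemma exists_event_oscillation_le.{u} {ε : ℝ} (hε : 0 < ε) :
    ∃ c : ℝ, 0 < c ∧ ∀ (Ω : Type u) [MeasurableSpace Ω] (P : Measure Ω) [IsProbabilityMeasure P]
      (W : ℝ≥0 → Ω → ℝ), IsBrownianReal W P → ∀ N : ℕ, 0 < N → ∃ D : Set Ω,
        P D ≤ ENNReal.ofReal (c * Real.exp (-(N : ℝ) ^ (ε / 2))) ∧
        ∀ ω ∉ D, ∀ l < N, ∀ τ : ℝ≥0, τ ≤ 1 →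
          |W ((l : ℝ≥0) / N + τ * (1 / N)) ω - W ((l : ℝ≥0) / N) ω|
            ≤ 16 * (N : ℝ) ^ (-(1 / 2) + ε / 2) := by
  obtain ⟨K, hK, hexp⟩ := exists_exp_neg_rpow_le hε
  refine ⟨8 * K, by positivity, fun Ω _ P _ W hW N hN => ?_⟩
  have hN1 : (1 : ℝ) ≤ N := by exact_mod_cast hN
  have hN0 : (0 : ℝ) < N := by linarith
  set A : ℝ := 4 * (N : ℝ) ^ (-(1 / 2) + ε / 2) with hA
  have hA0 : 0 ≤ A := by positivity
  set E : ℕ → Set Ω := fun j => ⋃ l ∈ Finset.range N, ⋃ i ∈ Finset.range (2 ^ j),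
    {ω | W ((l : ℝ≥0) / N + (i : ℝ≥0) / 2 ^ j * (1 / N) + 1 / 2 ^ j * (1 / N)) ω
      - W ((l : ℝ≥0) / N + (i : ℝ≥0) / 2 ^ j * (1 / N)) ω ∈ {z : ℝ | A * (3 / 4) ^ j < |z|}} with hE
  have hEj : ∀ j, P (E j) ≤ ENNReal.ofReal
      (2 * N * Real.exp (-(8 * (N : ℝ) ^ ε)) * (3 / 4) ^ j) := by
    intro j
    have hv : (0 : ℝ) < 1 / 2 ^ j * (1 / N) := by positivity
    have hz : MeasurableSet {z : ℝ | A * (3 / 4) ^ j < |z|} :=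
      measurableSet_lt (by fun_prop) (by fun_prop)
    have hone : ∀ l i : ℕ, P {ω | W ((l : ℝ≥0) / N + (i : ℝ≥0) / 2 ^ j * (1 / N)
          + 1 / 2 ^ j * (1 / N)) ω
        - W ((l : ℝ≥0) / N + (i : ℝ≥0) / 2 ^ j * (1 / N)) ω ∈ {z : ℝ | A * (3 / 4) ^ j < |z|}}
        ≤ ENNReal.ofReal (2 * (Real.exp (-(8 * (N : ℝ) ^ ε)) * Real.exp (-1) ^ j)) := by
      intro l i
      rw [measure_increment_mem hW.toIsPreBrownianReal _ _ hz]
      refine (gaussianReal_tail_le hv (by push_cast; rfl) (by positivity)).trans ?_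
      refine ENNReal.ofReal_le_ofReal ?_
      rw [← Real.exp_nat_mul, ← Real.exp_add]
      gcongr
      have hA2 : A ^ 2 = 16 * ((N : ℝ) ^ ε / N) := by
        rw [hA, mul_pow, ← Real.rpow_natCast, ← Real.rpow_natCast, ← Real.rpow_mul hN0.le,
          ← Real.rpow_sub_one hN0.ne']
        norm_num
        congr 1
        ring
      have e1 : (A * (3 / 4) ^ j) ^ 2 / (2 * (1 / 2 ^ j * (1 / (N : ℝ))))
          = 8 * (N : ℝ) ^ ε * (9 / 8) ^ j := by
        have e2 : ((3 / 4 : ℝ) ^ j) ^ 2 * 2 ^ j = (9 / 8) ^ j := by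
          rw [← pow_mul, mul_comm j 2, pow_mul, ← mul_pow]
          norm_num
        rw [mul_pow, hA2, ← e2]
        field_simp
        ring
      rw [e1]
      have h1 : 1 + (j : ℝ) * (1 / 8) ≤ (9 / 8) ^ j := by
        have := one_add_mul_le_pow (a := (1 / 8 : ℝ)) (by norm_num) j
        norm_num at this ⊢
        exact this
      have h2 : (1 : ℝ) ≤ (N : ℝ) ^ ε := Real.one_le_rpow hN1 hε.le
      have h3 := mul_le_mul_of_nonneg_left h1 (show 0 ≤ 8 * (N : ℝ) ^ ε by positivity)
      have h4 : (j : ℝ) ≤ (N : ℝ) ^ ε * j := le_mul_of_one_le_left (Nat.cast_nonneg _) h2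
      linarith
    calc P (E j) ≤ ∑ l ∈ Finset.range N, ∑ i ∈ Finset.range (2 ^ j),
          ENNReal.ofReal (2 * (Real.exp (-(8 * (N : ℝ) ^ ε)) * Real.exp (-1) ^ j)) := by
          refine (measure_biUnion_finset_le _ _).trans (Finset.sum_le_sum fun l _ => ?_)
          refine (measure_biUnion_finset_le _ _).trans (Finset.sum_le_sum fun i _ => hone l i)
      _ = ENNReal.ofReal (N * (2 ^ j * (2 * (Real.exp (-(8 * (N : ℝ) ^ ε)) * Real.exp (-1) ^ j)))) := by
          rw [Finset.sum_const, Finset.sum_const, Finset.card_range, Finset.card_range,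
            ← ENNReal.ofReal_nsmul, ← ENNReal.ofReal_nsmul]
          simp [nsmul_eq_mul]
      _ ≤ _ := by
          refine ENNReal.ofReal_le_ofReal ?_
          have h1 : 2 * Real.exp (-1) ≤ 3 / 4 := by
            rw [Real.exp_neg, ← div_eq_mul_inv, div_le_iff₀ (Real.exp_pos 1)]
            have := Real.exp_one_gt_d9
            linarith
          calc (N : ℝ) * (2 ^ j * (2 * (Real.exp (-(8 * (N : ℝ) ^ ε)) * Real.exp (-1) ^ j)))
              = 2 * N * Real.exp (-(8 * (N : ℝ) ^ ε)) * (2 * Real.exp (-1)) ^ j := by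
                rw [mul_pow]; ring
            _ ≤ _ := by gcongr
  refine ⟨(⋃ j, E j) ∪ {ω | ¬ Continuous (W · ω)}, ?_, ?_⟩
  · refine (measure_union_le _ _).trans ?_
    rw [show P {ω | ¬ Continuous (W · ω)} = 0 from hW.cont, add_zero]
    refine (measure_iUnion_le _).trans ((ENNReal.tsum_le_tsum hEj).trans ?_)
    have hs : Summable fun j : ℕ => (3 / 4 : ℝ) ^ j :=
      summable_geometric_of_lt_one (by norm_num) (by norm_num)
    rw [← ENNReal.ofReal_tsum_of_nonneg (fun j => by positivity) (hs.mul_left _), tsum_mul_left,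
      tsum_geometric_of_lt_one (by norm_num) (by norm_num)]
    refine ENNReal.ofReal_le_ofReal ?_
    have h1 := hexp N hN1
    have h2 : (N : ℝ) ^ (ε / 2) ≤ (N : ℝ) ^ ε :=
      Real.rpow_le_rpow_of_exponent_le hN1 (by linarith)
    have h3 : (0 : ℝ) ≤ (N : ℝ) ^ ε := by positivity
    have h4 : Real.exp (-(8 * (N : ℝ) ^ ε))
        ≤ Real.exp (-((N : ℝ) ^ ε / 2)) * Real.exp (-(N : ℝ) ^ (ε / 2)) := by
      rw [← Real.exp_add]
      exact Real.exp_le_exp.2 (by linarith)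
    have h5 : (N : ℝ) * (N : ℝ) ^ (-2 : ℝ) ≤ 1 := by
      nth_rewrite 1 [← Real.rpow_one (N : ℝ)]
      rw [← Real.rpow_add hN0]
      exact Real.rpow_le_one_of_one_le_of_nonpos hN1 (by norm_num)
    calc 2 * N * Real.exp (-(8 * (N : ℝ) ^ ε)) * (1 - 3 / 4)⁻¹
        = 8 * (N * Real.exp (-(8 * (N : ℝ) ^ ε))) := by norm_num; ring
      _ ≤ 8 * (N * ((K * (N : ℝ) ^ (-2 : ℝ)) * Real.exp (-(N : ℝ) ^ (ε / 2)))) := by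
        gcongr
        exact h4.trans (by gcongr)
      _ = 8 * K * Real.exp (-(N : ℝ) ^ (ε / 2)) * (N * (N : ℝ) ^ (-2 : ℝ)) := by ring
      _ ≤ 8 * K * Real.exp (-(N : ℝ) ^ (ε / 2)) * 1 := by gcongr
      _ = _ := mul_one _
  · intro ω hω l hl τ hτ
    have hc : Continuous (W · ω) := by
      by_contra hc
      exact hω (Or.inr hc)
    have := abs_sub_le_of_dyadic hc hA0 ((l : ℝ≥0) / N) (1 / N) (fun j i hi => ?_) hτ
    · exact this.trans (le_of_eq (by rw [hA]; ring))
    · by_contra hcon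
      refine hω (Or.inl (Set.mem_iUnion.2 ⟨j, ?_⟩))
      simp only [hE, Set.mem_iUnion]
      refine ⟨l, Finset.mem_range.2 hl, i, Finset.mem_range.2 hi, ?_⟩
      have e : (l : ℝ≥0) / N + ((i + 1 : ℕ) : ℝ≥0) / 2 ^ j * (1 / N)
          = (l : ℝ≥0) / N + (i : ℝ≥0) / 2 ^ j * (1 / N) + 1 / 2 ^ j * (1 / N) := by
        push_cast; ring
      rw [e] at hcon
      exact not_le.1 hcon

end Oscillation

/-! ### From common rectangles to near grid times. -/

section Rectangles

/-- The values of `f` at the grid points `l / N`, extended by constancy beyond `l = N`. -/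
noncomputable def gridSample (f : unitInterval → ℝ) (N l : ℕ) : ℝ :=
  f (Set.projIcc (0 : ℝ) 1 zero_le_one ((l : ℝ) / N))

lemma gridSample_mem {α : ℝ} (hα : 0 ≤ α) {f : unitInterval → ℝ} (hf : f ∈ holderClass α) (N : ℕ) :
    gridSample f N ∈ gridHolder α N := by
  refine ⟨fun l => hf.1 _, fun k l => (hf.2 _ _).trans ?_⟩
  refine Real.rpow_le_rpow (abs_nonneg _) ?_ hα
  refine (Set.abs_projIcc_sub_projIcc zero_le_one).trans (le_of_eq ?_)
  rw [← sub_div, abs_div, abs_of_nonneg (Nat.cast_nonneg N : (0 : ℝ) ≤ N)]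

/-- A rectangle met by both graphs lies over a grid point where the two functions are close, and
its height is determined by the value of `f` there up to a bounded number of choices. -/
lemma commonRects_subset {α : ℝ} (hα : 0 < α) {N : ℕ} (hN : 0 < N) {f : unitInterval → ℝ}
    (hf : f ∈ holderClass α) {w : ℝ≥0 → ℝ} {b : ℕ → ℝ} (hb : ∀ l, b l = w ((l : ℝ≥0) / N))
    {r r' : ℝ}
    (hosc : ∀ l < N, ∀ τ : ℝ≥0, τ ≤ 1 →
      |w ((l : ℝ≥0) / N + τ * (1 / N)) - w ((l : ℝ≥0) / N)| ≤ r')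
    (hr : r' + 2 * (1 / (N : ℝ) ^ α) ≤ r) :
    commonRects α N f w ⊆ ((nearTimes b (gridSample f N) N r ×ˢ Finset.Icc (-2 : ℤ) 2).image
      fun q : ℕ × ℤ => (q.1, ⌊(N : ℝ) ^ α * gridSample f N q.1⌋ + q.2) : Finset (ℕ × ℤ)) := by
  rintro ⟨l, m⟩ ⟨-, -, -, hsub, ⟨_, hs, ⟨s, rfl⟩⟩, ⟨_, ht, ⟨t, rfl⟩⟩⟩
  have hN0 : (0 : ℝ) < N := by exact_mod_cast hN
  have hN0' : (0 : ℝ≥0) < N := by exact_mod_cast hN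
  have hG : (0 : ℝ) < (N : ℝ) ^ α := by positivity
  simp only [gridRect, Set.mem_prod, Set.mem_Icc] at hs ht
  obtain ⟨⟨hs1, hs2⟩, hs3, hs4⟩ := hs
  obtain ⟨⟨ht1, ht2⟩, ht3, ht4⟩ := ht
  -- Containment in the unit strip excludes the column `l = N`.
  have hl1 : ((l : ℝ) + 1) / N ≤ 1 := by
    have hmem : ((((l : ℝ) + 1) / N, (m : ℝ) / (N : ℝ) ^ α) : ℝ × ℝ) ∈ gridRect α N l m := by
      refine ⟨⟨?_, le_rfl⟩, ⟨le_rfl, ?_⟩⟩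
      · exact div_le_div_of_nonneg_right (by linarith) hN0.le
      · exact div_le_div_of_nonneg_right (by linarith) hG.le
    exact (hsub hmem).1.2
  have hlN : l < N := by
    rw [div_le_one hN0] at hl1
    exact_mod_cast hl1
  have hl01 : (l : ℝ) / N ∈ Set.Icc (0 : ℝ) 1 :=
    ⟨by positivity, by rw [div_le_one hN0]; exact_mod_cast hlN.le⟩
  have hy : gridSample f N l = f ⟨(l : ℝ) / N, hl01⟩ := by
    rw [gridSample, Set.projIcc_of_mem zero_le_one hl01]
  have hfy : |f s - gridSample f N l| ≤ 1 / (N : ℝ) ^ α := by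
    rw [hy]
    refine (hf.2 _ _).trans ?_
    rw [one_div, ← Real.inv_rpow hN0.le]
    refine Real.rpow_le_rpow (abs_nonneg _) ?_ hα.le
    rw [abs_of_nonneg (by simpa using hs1), ← one_div]
    rw [add_div] at hs2
    simp only
    linarith
  have hwf : |w t - f s| ≤ 1 / (N : ℝ) ^ α := by
    rw [add_div] at ht4 hs4
    rw [abs_le]
    constructor <;> linarith
  have hlt : (l : ℝ≥0) / N ≤ t := by
    rw [← NNReal.coe_le_coe]; push_cast; exact ht1
  have hτ : (t - (l : ℝ≥0) / N) * N ≤ 1 := by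
    rw [← NNReal.coe_le_coe, NNReal.coe_mul, NNReal.coe_sub hlt]
    push_cast
    rw [← le_div_iff₀ hN0]
    rw [add_div] at ht2
    linarith
  have ho := hosc l hlN _ hτ
  have hte : (l : ℝ≥0) / N + (t - (l : ℝ≥0) / N) * N * (1 / N) = t := by
    rw [mul_assoc, mul_one_div_cancel hN0'.ne', mul_one, add_tsub_cancel_of_le hlt]
  rw [hte] at ho
  have hnear : |b l - gridSample f N l| ≤ r := by
    rw [hb]
    refine le_trans ?_ hr
    calc |w ((l : ℝ≥0) / N) - gridSample f N l|
        = |(w ((l : ℝ≥0) / N) - w t) + (w t - f s) + (f s - gridSample f N l)| := by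
          congr 1; ring
      _ ≤ _ := abs_add_three _ _ _
      _ ≤ _ := by rw [abs_sub_comm (w ((l : ℝ≥0) / N))]; linarith
  have hv : |(N : ℝ) ^ α * f s - (N : ℝ) ^ α * gridSample f N l| ≤ 1 := by
    rw [← mul_sub, abs_mul, abs_of_pos hG]
    calc _ ≤ (N : ℝ) ^ α * (1 / (N : ℝ) ^ α) := by gcongr
      _ = 1 := mul_one_div_cancel hG.ne'
  rw [div_le_iff₀' hG] at hs3
  rw [le_div_iff₀' hG] at hs4
  obtain ⟨hv1, hv2⟩ := abs_le.1 hv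
  have hfl := Int.floor_le ((N : ℝ) ^ α * gridSample f N l)
  have hfl' := Int.lt_floor_add_one ((N : ℝ) ^ α * gridSample f N l)
  -- `f` varies by at most one cell height over a column; with the rounding this leaves five
  -- possible values of `m`.
  have hm1 : m ≤ ⌊(N : ℝ) ^ α * gridSample f N l⌋ + 2 := by
    have : (m : ℝ) ≤ ⌊(N : ℝ) ^ α * gridSample f N l⌋ + 2 := by linarith
    exact_mod_cast this
  have hm2 : ⌊(N : ℝ) ^ α * gridSample f N l⌋ ≤ m + 2 := by
    have : (⌊(N : ℝ) ^ α * gridSample f N l⌋ : ℝ) ≤ m + 2 := by linarith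
    exact_mod_cast this
  refine Finset.mem_coe.2 (Finset.mem_image.2
    ⟨(l, m - ⌊(N : ℝ) ^ α * gridSample f N l⌋), Finset.mem_product.2 ⟨?_, ?_⟩, ?_⟩)
  · exact Finset.mem_filter.2 ⟨Finset.mem_range.2 hlN, hnear⟩
  · rw [Finset.mem_Icc]
    constructor <;> linarith
  · simp

lemma card_le_blockCount_mul (S : Finset ℕ) {L : ℕ} (hL : 0 < L) :
    S.card ≤ L * blockCount S L := by
  refine Finset.card_le_mul_card_image S L fun k _ => ?_
  have hsub : S.filter (fun l => l / L = k) ⊆ Finset.Ico (k * L) (k * L + L) := by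
    intro l hl
    obtain ⟨-, rfl⟩ := Finset.mem_filter.1 hl
    exact Finset.mem_Ico.2 ⟨Nat.div_mul_le_self l L, Nat.lt_div_mul_add hL⟩
  simpa using Finset.card_le_card hsub

end Rectangles

theorem proposition2 (α : ℝ) (hα : α ∈ Set.Ioc (1 / 2 : ℝ) 1)
    (ε : ℝ) (hε : ε ∈ Set.Ioo (0 : ℝ) (1 / 16)) :
    ∃ c₁ c₂ c₃ : ℝ, 0 < c₁ ∧ 0 < c₂ ∧ 0 < c₃ ∧
      ∀ (Ω : Type*) [MeasurableSpace Ω] (P : Measure Ω) [IsProbabilityMeasure P]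
        (W : ℝ≥0 → Ω → ℝ), IsBrownianReal W P →
        ∀ N : ℕ, 0 < N →
          ∃ D : Set Ω, MeasurableSet D ∧
            P D ≤ ENNReal.ofReal (c₁ * Real.exp (-c₂ * (N : ℝ) ^ (ε / 2))) ∧
            ∀ ω ∉ D, ∀ f ∈ holderClass α,
              (commonRects α N f (fun t => W t ω)).Finite ∧
              ((commonRects α N f (fun t => W t ω)).ncard : ℝ) ≤
                c₃ * (N : ℝ) ^ (1 / 2 + 2 * ε) := by
  obtain ⟨hα1, -⟩ := hα
  obtain ⟨hε0, hε1⟩ := hε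
  obtain ⟨c, c₃, hc, hc₃, hhit⟩ :=
    -- The radius constant is `18 = 16 + 2`, from the oscillation and two cell heights. With `δ = ε
    -- / 2` the exponents add up: `ε + ((1 - ε) / 2 + ε + ε / 2) = 1 / 2 + 2 * ε`.
    HitBound.final hα1 hε0 (by linarith) (by norm_num : (0 : ℝ) ≤ 18) (ε / 2) (by positivity)
  obtain ⟨c', hc', hosc⟩ := exists_event_oscillation_le hε0
  refine ⟨c + c', 1, 5 * c₃, by positivity, one_pos, by positivity, ?_⟩
  intro Ω _ P _ W hW N hN
  have hN1 : (1 : ℝ) ≤ N := by exact_mod_cast hN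
  have hN0 : (0 : ℝ) < N := by linarith
  -- `W t` is only almost everywhere measurable. The block estimates see countably many times `l /
  -- N`, so a measurable modification serves there, off the null set `D₃`; path continuity is used
  -- only for `W` itself.
  set B : ℝ≥0 → Ω → ℝ := fun t => (hW.aemeasurable t).mk (W t) with hB
  have hWB : ∀ t, W t =ᵐ[P] B t := fun t => (hW.aemeasurable t).ae_eq_mk
  obtain ⟨D₁, hD₁, hD₁ω⟩ := hhit Ω P B (hW.toIsPreBrownianReal.congr hWB)
    (fun t => (hW.aemeasurable t).measurable_mk) N hN
  obtain ⟨D₂, hD₂, hD₂ω⟩ := hosc Ω P W hW N hN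
  set D₃ : Set Ω := {ω | ¬ ∀ l : ℕ, W ((l : ℝ≥0) / N) ω = B ((l : ℝ≥0) / N) ω} with hD₃
  have hD₃0 : P D₃ = 0 := ae_all_iff.2 fun l : ℕ => hWB ((l : ℝ≥0) / N)
  refine ⟨toMeasurable P (D₁ ∪ D₂ ∪ D₃), measurableSet_toMeasurable _ _, ?_, fun ω hω f hf => ?_⟩
  · rw [measure_toMeasurable]
    refine (measure_union_le _ _).trans ?_
    rw [hD₃0, add_zero]
    refine (measure_union_le _ _).trans ((add_le_add hD₁ hD₂).trans (le_of_eq ?_))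
    rw [← ENNReal.ofReal_add (by positivity) (by positivity), add_mul, neg_one_mul]
  have hω' : ω ∉ D₁ ∪ D₂ ∪ D₃ := fun h => hω (subset_toMeasurable _ _ h)
  simp only [Set.mem_union, not_or] at hω'
  obtain ⟨⟨hω1, hω2⟩, hω3⟩ := hω'
  have hWBω : ∀ l : ℕ, B ((l : ℝ≥0) / N) ω = W ((l : ℝ≥0) / N) ω := fun l => by
    by_contra h
    exact hω3 fun h' => h (h' l).symm
  have hα0 : 0 < α := by linarith
  have hr : 16 * (N : ℝ) ^ (-(1 / 2) + ε / 2) + 2 * (1 / (N : ℝ) ^ α)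
      ≤ 18 * (N : ℝ) ^ (-(1 / 2) + ε / 2) := by
    have : 1 / (N : ℝ) ^ α ≤ (N : ℝ) ^ (-(1 / 2) + ε / 2) := by
      rw [one_div, ← Real.rpow_neg hN0.le]
      exact Real.rpow_le_rpow_of_exponent_le hN1 (by linarith)
    linarith
  have hsub := commonRects_subset hα0 hN hf (w := fun t => W t ω)
    (b := fun l => B ((l : ℝ≥0) / N) ω) hWBω (hD₂ω ω hω2) hr
  refine ⟨(Finset.finite_toSet _).subset hsub, ?_⟩
  have hcount := hD₁ω ω hω1 _ (gridSample_mem hα0.le hf N)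
  set S := nearTimes (fun l => B ((l : ℝ≥0) / N) ω) (gridSample f N) N
    (18 * (N : ℝ) ^ (-(1 / 2) + ε / 2)) with hS
  have h1 : (commonRects α N f (fun t => W t ω)).ncard ≤ S.card * 5 := by
    refine (Set.ncard_le_ncard hsub (Finset.finite_toSet _)).trans ?_
    rw [Set.ncard_coe_finset]
    refine Finset.card_image_le.trans ?_
    rw [Finset.card_product]
    rfl
  have h2 := card_le_blockCount_mul S (blockLen_pos (1 - ε) N)
  have h3 : (blockLen (1 - ε) N : ℝ) ≤ (N : ℝ) ^ ε := by
    simpa using blockLen_le (a := 1 - ε) (by linarith) hN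
  calc ((commonRects α N f (fun t => W t ω)).ncard : ℝ) ≤ S.card * 5 := by exact_mod_cast h1
    _ ≤ (blockLen (1 - ε) N * blockCount S (blockLen (1 - ε) N)) * 5 := by
      gcongr; exact_mod_cast h2
    _ ≤ ((N : ℝ) ^ ε * (c₃ * (N : ℝ) ^ ((1 - ε) / 2 + ε + ε / 2))) * 5 := by gcongr
    _ = 5 * c₃ * ((N : ℝ) ^ ε * (N : ℝ) ^ ((1 - ε) / 2 + ε + ε / 2)) := by ring
    _ = _ := by
      rw [← Real.rpow_add hN0]
      congr 2
      ring
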